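/- Let $r, m, p$ be integers with $2\le r<m$ and $p\ge 0$, let $M^r$ be a smooth $r$-dimensional manifold without boundary, and let $u: M^r\to\mathbb{R}^{r+p}$ be a smooth immersion. Then the cylinder over $u$, $$f=(u,\mathrm{id}): M^r\times\mathbb{R}^{m-r}\longrightarrow \mathbb{R}^{r+p}\times\mathbb{R}^{m-r}=\mathbb{R}^{m+p},\qquad f(x,y)=(u(x),y),$$ is a Wintgen ideal submanifold if and only if $u$ is a minimal Wintgen ideal submanifold. Here an immersion $f:M^m\to\mathbb{R}^{m+p}$ (with $m\ge 2$) is called Wintgen ideal if at every point of $M^m$ equality holds in the DDVV inequality $s\le \|H\|^2-s^{\perp}$, where $$s=\frac{2}{m(m-1)}\sum_{1\le i<j\le m}\langle R(e_i,e_j)e_j,e_i\rangle,\qquad s^{\perp}=\frac{2}{m(m-1)}\Big(\sum_{1\le i<j\le m}\ \sum_{1\le\alpha<\beta\le p}\langle R^{\perp}(e_i,e_j)n_\alpha,n_\beta\rangle^2\Big)^{1/2},$$ $R$ is the Riemann curvature tensor of the induced metric, $R^{\perp}$ is the curvature tensor of the normal connection, $H=\frac1m\sum_j II(e_j,e_j)$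 is the mean curvature vector ($II$ being the second fundamental form), and $(e_i)$, $(n_\alpha)$ are orthonormal bases of the tangent and the normal space. The immersion is minimal if $H=0$ at every point. -/

import Mathlib

open scoped Manifold ContDiff InnerProductSpace

noncomputable section

/-! ### Curvature of a Riemannian metric in a coordinate domain

`g y v w` is the value at the point `y` of the metric on the tangent vectors `v`, `w`. A vector of
the coordinate space `E` is also read as the coordinate vector field constantly equal to it;
such fields commute. -/

section Intrinsic

variable {E : Type*} [NormedAddCommGroup E] [NormedSpace ℝ E] [FiniteDimensional ℝ E]

/-- Christoffel symbol of the first kind: `g (∇_v w, z)` for constant fields `v`, `w`, `z`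
(the Koszul formula of the Levi-Civita connection `∇`). -/
def christoffelFirst (g : E → E → E → ℝ) (y v w z : E) : ℝ :=
  (1 / 2) * (fderiv ℝ (fun q => g q w z) y v + fderiv ℝ (fun q => g q v z) y w
    - fderiv ℝ (fun q => g q v w) y z)

/-- The matrix `(g_{ij})` of the metric with respect to a fixed basis of `E`. -/
def gramMatrix (g : E → E → E → ℝ) (y : E) :
    Matrix (Fin (Module.finrank ℝ E)) (Fin (Module.finrank ℝ E)) ℝ :=
  Matrix.of fun i j => g y (Module.finBasis ℝ E i) (Module.finBasis ℝ E j)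

/-- Christoffel symbol of the second kind: the vector `∇_v w` at `y`, for the Levi-Civita
connection `∇` of `g` and constant fields `v`, `w`. -/
def christoffel (g : E → E → E → ℝ) (y v w : E) : E :=
  ∑ k, ∑ l, ((gramMatrix g y)⁻¹ k l * christoffelFirst g y v w (Module.finBasis ℝ E l)) •
    Module.finBasis ℝ E k

/-- The Levi-Civita derivative `∇_v Z` at `y` of a vector field `Z` in the direction `v`. -/
def leviCivita (g : E → E → E → ℝ) (v : E) (Z : E → E) (y : E) : E :=
  fderiv ℝ Z y v + christoffel g y v (Z y)

/-- The Riemannian curvature `R(v,w)z = ∇_v ∇_w z - ∇_w ∇_v z` (for constant fields) at `y`. -/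
def riemannCurvature (g : E → E → E → ℝ) (y v w z : E) : E :=
  leviCivita g v (leviCivita g w fun _ => z) y - leviCivita g w (leviCivita g v fun _ => z) y

/-- The normalized scalar curvature
`s = 2 / (m (m - 1)) * ∑_{i<j} ⟨R(e_i,e_j)e_j, e_i⟩` at `y`, in an orthonormal basis `e`. -/
def normalizedScalarCurvature (g : E → E → E → ℝ) (y : E) {m : ℕ} (e : Fin m → E) : ℝ :=
  2 / ((m : ℝ) * ((m : ℝ) - 1)) *
    ∑ i, ∑ j ∈ Finset.Ioi i, g y (riemannCurvature g y (e i) (e j) (e j)) (e i)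

end Intrinsic

/-! ### Immersions `F` of a coordinate domain of `E` in a Euclidean space `V` -/

section Extrinsic

variable {E : Type*} [NormedAddCommGroup E] [NormedSpace ℝ E] [FiniteDimensional ℝ E]
  {V : Type*} [NormedAddCommGroup V] [InnerProductSpace ℝ V] [FiniteDimensional ℝ V]

/-- The first fundamental form `I = dF · dF` (the induced metric). -/
def firstFundamentalForm (F : E → V) (y v w : E) : ℝ :=
  ⟪fderiv ℝ F y v, fderiv ℝ F y w⟫_ℝ

/-- The orthogonal projection of `V` onto the normal space of `F` at `y`. -/
def normalProjection (F : E → V) (y : E) : V →L[ℝ] V :=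
  (LinearMap.range (fderiv ℝ F y).toLinearMap)ᗮ.starProjection

/-- The second fundamental form `II(v,w)`: the normal part of the derivative of `dF(w)` along
`v`. -/
def secondFundamentalForm (F : E → V) (y v w : E) : V :=
  normalProjection F y (fderiv ℝ (fun q => fderiv ℝ F q w) y v)

/-- The mean curvature vector `H = (1 / m) ∑_j II(e_j,e_j)`, in an orthonormal tangent
basis `e`. -/
def meanCurvatureVector (F : E → V) (y : E) {m : ℕ} (e : Fin m → E) : V :=
  (1 / (m : ℝ)) • ∑ j, secondFundamentalForm F y (e j) (e j)

/-- The normal connection `∇^⊥_v ξ` at `y` for a normal field `ξ` along `F`. -/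
def normalConnection (F : E → V) (v : E) (ξ : E → V) (y : E) : V :=
  normalProjection F y (fderiv ℝ ξ y v)

/-- The normal curvature `R^⊥(v,w)ν = ∇^⊥_v ∇^⊥_w ν - ∇^⊥_w ∇^⊥_v ν` at `y` (for constant
fields `v`, `w`), where the vector `ν`, normal at `y`, is extended to the normal field
`q ↦ normalProjection F q ν`; by tensoriality the extension does not matter. -/
def normalCurvature (F : E → V) (y v w : E) (ν : V) : V :=
  normalConnection F v (normalConnection F w fun q => normalProjection F q ν) y
    - normalConnection F w (normalConnection F v fun q => normalProjection F q ν) y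

/-- The normalized normal curvature `s^⊥ = 2 / (m (m - 1)) * ‖R^⊥‖` at `y`, where
`‖R^⊥‖² = ∑_{i<j} ∑_{α<β} ⟨R^⊥(e_i,e_j)ν_α, ν_β⟩²`, in an orthonormal tangent basis `e` and an
orthonormal normal basis `ν`. -/
def normalizedNormalCurvature (F : E → V) (y : E) {m p : ℕ} (e : Fin m → E) (ν : Fin p → V) : ℝ :=
  2 / ((m : ℝ) * ((m : ℝ) - 1)) *
    √(∑ i, ∑ j ∈ Finset.Ioi i, ∑ α, ∑ β ∈ Finset.Ioi α,
      ⟪normalCurvature F y (e i) (e j) (ν α), ν β⟫_ℝ ^ 2)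

/-- `e` is orthonormal for the induced metric at `y` (with `m = dim E`: an orthonormal basis of
the tangent space). -/
def IsTangentFrame (F : E → V) (y : E) {m : ℕ} (e : Fin m → E) : Prop :=
  Orthonormal ℝ fun i => fderiv ℝ F y (e i)

/-- `ν` is an orthonormal family of vectors normal to `F` at `y` (with `p` the codimension: an
orthonormal basis of the normal space). -/
def IsNormalFrame (F : E → V) (y : E) {p : ℕ} (ν : Fin p → V) : Prop :=
  Orthonormal ℝ ν ∧ ∀ α v, ⟪fderiv ℝ F y v, ν α⟫_ℝ = 0

end Extrinsic

/-! ### Submanifolds of Euclidean space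

The manifolds are modelled on `I : ModelWithCorners ℝ E H` and have no boundary. -/

section Submanifold

variable {E : Type*} [NormedAddCommGroup E] [NormedSpace ℝ E] [FiniteDimensional ℝ E]
  {H : Type*} [TopologicalSpace H] (I : ModelWithCorners ℝ E H)
  {M : Type*} [TopologicalSpace M] [ChartedSpace H M]
  {V : Type*} [NormedAddCommGroup V] [InnerProductSpace ℝ V] [FiniteDimensional ℝ V]

/-- `f : M^m → ℝ^{m+p}` is a smooth immersion. -/
structure IsImmersedSubmanifold (m p : ℕ) (f : M → V) : Prop where
  finrank_model : Module.finrank ℝ E = m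
  finrank_ambient : Module.finrank ℝ V = m + p
  contMDiff : ContMDiff I 𝓘(ℝ, V) ∞ f
  injective_mfderiv : ∀ x, Function.Injective (mfderiv I 𝓘(ℝ, V) f x)

/-- `f` in the local coordinates around `x`. The point `x` has the coordinates
`extChartAt I x x`. -/
def localParametrization (f : M → V) (x : M) : E → V :=
  f ∘ (extChartAt I x).symm

/-- `f : M^m → ℝ^{m+p}` is a minimal submanifold: an immersion with mean curvature vector
zero at every point. -/
def IsMinimalSubmanifold (m p : ℕ) (f : M → V) : Prop :=
  IsImmersedSubmanifold I m p f ∧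
    ∀ x : M, ∀ e : Fin m → E,
      IsTangentFrame (localParametrization I f x) (extChartAt I x x) e →
      meanCurvatureVector (localParametrization I f x) (extChartAt I x x) e = 0

/-- `f : M^m → ℝ^{m+p}` is a Wintgen ideal submanifold: an immersion that attains at every point
equality in the DDVV inequality `s ≤ ‖H‖² - s^⊥`. (The three quantities do not depend on the
orthonormal bases.) -/
def IsWintgenIdeal (m p : ℕ) (f : M → V) : Prop :=
  IsImmersedSubmanifold I m p f ∧
    ∀ x : M, ∀ (e : Fin m → E) (ν : Fin p → V),
      IsTangentFrame (localParametrization I f x) (extChartAt I x x) e →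
      IsNormalFrame (localParametrization I f x) (extChartAt I x x) ν →
      normalizedScalarCurvature (firstFundamentalForm (localParametrization I f x))
          (extChartAt I x x) e =
        ‖meanCurvatureVector (localParametrization I f x) (extChartAt I x x) e‖ ^ 2
          - normalizedNormalCurvature (localParametrization I f x) (extChartAt I x x) e ν

end Submanifold

/-- The cylinder `f = (u, id) : M × W → V × W` over `u : M → V`; the product `V × W` of the
Euclidean spaces `V` and `W` carries the Euclidean norm. -/
def cylinder {M V : Type*} (W : Type*) (u : M → V) : M × W → WithLp 2 (V × W) :=
  fun q => WithLp.toLp 2 (u q.1, q.2)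

end

/-!
By the equations of Gauss and Ricci (`IsSmoothImmersionAt.gauss_equation`,
`IsSmoothImmersionAt.ricci_equation`), equality in the DDVV inequality at a point of an
`m`-dimensional submanifold is the condition
`(∑ (tr A_α)²) / m + √(∑ ‖[A_α, A_β]‖²) = ∑ ‖A_α‖²`
on the components `A_α` of the second fundamental form in orthonormal frames
(`IsSmoothImmersionAt.wintgen_iff`). The cylinder has the same normal vectors as `u`, and
for a common normal frame and arbitrary tangent frames its components are `C A_α Cᵀ` with
`Cᵀ C = 1` (`exists_shapeMatrix_cylinder_eq_conj`). Hence all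
the traces and norms above agree for `u` and for the cylinder, and only the denominator `m`
differs from the denominator `r` of `u`.

If `u` is minimal the first term vanishes and the two conditions coincide. Conversely, the DDVV
inequality for `u` itself says that the left side, with denominator `r`, is at most the right side;
equality with the larger denominator `m` then forces all the traces to vanish
(`isWintgenFamily_iff_of_card_lt`).

The DDVV inequality reduces, by removing traces, to
`∑ ‖[A_α, A_β]‖² ≤ (∑ ‖A_α‖²)²` for symmetric matrices (`sum_commutatorSq_le_sq`), which is proved
by Lu's method: a maximizer on the unit sphere can be rotated to an orthogonal family, where the
first variation in the length of its longest member is controlled by a bound for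
`∑ ‖[A, A_β]‖²` in the eigenbasis of `A` (`sum_commutatorSq_le`).
-/

open Matrix Filter Topology

/-! ### The algebraic DDVV inequality -/

section DDVV

variable {n κ : Type*} [Fintype n] [Fintype κ]

/-- The Frobenius inner product of two real matrices. -/
def frobeniusInner (A B : Matrix n n ℝ) : ℝ := ∑ i, ∑ j, A i j * B i j

/-- The squared Frobenius norm of a real matrix. -/
def frobeniusSq (A : Matrix n n ℝ) : ℝ := ∑ i, ∑ j, A i j ^ 2

lemma frobeniusInner_self (A : Matrix n n ℝ) : frobeniusInner A A = frobeniusSq A := by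
  simp [frobeniusInner, frobeniusSq, sq]

lemma frobeniusSq_nonneg (A : Matrix n n ℝ) : 0 ≤ frobeniusSq A := by
  unfold frobeniusSq; positivity

lemma frobeniusSq_eq_trace (A : Matrix n n ℝ) : frobeniusSq A = trace (A * Aᵀ) := by
  simp [frobeniusSq, trace, mul_apply, sq]

lemma frobeniusSq_smul (c : ℝ) (A : Matrix n n ℝ) :
    frobeniusSq (c • A) = c ^ 2 * frobeniusSq A := by
  simp [frobeniusSq, Finset.mul_sum, mul_pow]

lemma frobeniusSq_zero : frobeniusSq (0 : Matrix n n ℝ) = 0 := by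
  simp [frobeniusSq]

lemma eq_zero_of_frobeniusSq_eq_zero {A : Matrix n n ℝ} (h : frobeniusSq A = 0) : A = 0 := by
  ext i j
  have h1 := (Finset.sum_eq_zero_iff_of_nonneg (fun i _ => by positivity)).1 h i (Finset.mem_univ i)
  have h2 := (Finset.sum_eq_zero_iff_of_nonneg (fun j _ => by positivity)).1 h1 j
    (Finset.mem_univ j)
  simpa using h2

lemma frobeniusInner_sum_smul_left (c : κ → ℝ) (A : κ → Matrix n n ℝ) (B : Matrix n n ℝ) :
    frobeniusInner (∑ k, c k • A k) B = ∑ k, c k * frobeniusInner (A k) B := by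
  simp only [frobeniusInner, Matrix.sum_apply, Matrix.smul_apply, smul_eq_mul, Finset.sum_mul,
    Finset.mul_sum]
  rw [Finset.sum_comm_cycle]
  exact Finset.sum_congr rfl fun k _ => Finset.sum_congr rfl fun _ _ =>
    Finset.sum_congr rfl fun _ _ => by ring

lemma frobeniusInner_comm (A B : Matrix n n ℝ) : frobeniusInner A B = frobeniusInner B A := by
  simp [frobeniusInner, mul_comm]

lemma frobeniusInner_sum_smul_right (c : κ → ℝ) (A : κ → Matrix n n ℝ) (B : Matrix n n ℝ) :
    frobeniusInner B (∑ k, c k • A k) = ∑ k, c k * frobeniusInner B (A k) := by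
  simp_rw [frobeniusInner_comm B, frobeniusInner_sum_smul_left]

/-- The bound `|J| + 1` for the largest Laplacian eigenvalue of a star with
centre `c` and leaves `J`. -/
lemma sum_sq_sub_le_of_star [DecidableEq n] (η : n → ℝ) (c : n) (J : Finset n) (hc : c ∉ J) :
    ∑ j ∈ J, (η c - η j) ^ 2 ≤ (J.card + 1) * ∑ i, η i ^ 2 := by
  have h1 : η c ^ 2 + ∑ j ∈ J, η j ^ 2 ≤ ∑ i, η i ^ 2 := by
    rw [← Finset.sum_insert (f := fun j => η j ^ 2) hc]
    exact Finset.sum_le_sum_of_subset_of_nonneg (Finset.subset_univ _)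
      fun _ _ _ => sq_nonneg _
  have h2 : (∑ j ∈ J, η j) ^ 2 ≤ J.card * ∑ j ∈ J, η j ^ 2 := sq_sum_le_card_mul_sum_sq
  have h3 : ∑ j ∈ J, (η c - η j) ^ 2
      = J.card * η c ^ 2 - 2 * η c * (∑ j ∈ J, η j) + ∑ j ∈ J, η j ^ 2 := by
    simp only [sub_sq, Finset.sum_add_distrib, Finset.sum_sub_distrib, Finset.mul_sum,
      Finset.sum_const, nsmul_eq_mul]
  have h4 : ((J.card : ℝ) + 1) * (η c ^ 2 + ∑ j ∈ J, η j ^ 2) ≤ (J.card + 1) * ∑ i, η i ^ 2 := by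
    gcongr
  nlinarith [sq_nonneg (η c + ∑ j ∈ J, η j)]

lemma sq_add_sq_le_sum_sq [DecidableEq n] (η : n → ℝ) {i j : n} (hij : i ≠ j) :
    η i ^ 2 + η j ^ 2 ≤ ∑ k, η k ^ 2 := by
  rw [← Finset.sum_pair (f := fun k => η k ^ 2) hij]
  exact Finset.sum_le_sum_of_subset_of_nonneg (Finset.subset_univ _) fun _ _ _ => sq_nonneg _

/-- Two pairs of entries whose differences both exceed the norm of `η` are not disjoint, because
`(a - b) ^ 2 ≤ 2 * (a ^ 2 + b ^ 2)`. -/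
lemma eq_or_eq_of_sum_sq_lt [DecidableEq n] (η : n → ℝ) {i j k l : n}
    (hij : ∑ a, η a ^ 2 < (η i - η j) ^ 2) (hkl : ∑ a, η a ^ 2 < (η k - η l) ^ 2) :
    i = k ∨ i = l ∨ j = k ∨ j = l := by
  by_contra! h
  obtain ⟨h1, h2, h3, h4⟩ := h
  have hx : 0 ≤ ∑ a, η a ^ 2 := by positivity
  have hij' : i ≠ j := by rintro rfl; simp at hij; linarith
  have hkl' : k ≠ l := by rintro rfl; simp at hkl; linarith
  have h5 : ∑ a ∈ ({i, j, k, l} : Finset n), η a ^ 2 ≤ ∑ a, η a ^ 2 :=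
    Finset.sum_le_sum_of_subset_of_nonneg (Finset.subset_univ _) fun _ _ _ => sq_nonneg _
  rw [Finset.sum_insert (by simp [*]), Finset.sum_insert (by simp [*]),
    Finset.sum_pair hkl'] at h5
  nlinarith [sq_nonneg (η i + η j), sq_nonneg (η k + η l)]

/-- The pairs of entries whose difference exceeds the norm of `η` form a star: they meet pairwise,
and they contain no triangle, since the two steps of a triangle that lie inside the third would
make the latter too long. -/
lemma exists_center [DecidableEq n] [Nonempty n] (η : n → ℝ) :
    ∃ c, ∀ i j, ∑ a, η a ^ 2 < (η i - η j) ^ 2 → i = c ∨ j = c := by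
  obtain ⟨t, ht⟩ := Finite.exists_max η
  obtain ⟨b, hb⟩ := Finite.exists_min η
  by_contra! h
  -- a large pair avoiding `t` contains `b`, a large pair avoiding `b` contains `t`
  obtain ⟨i, j, hij, hit, hjt⟩ := h t
  obtain ⟨k, l, hkl, hkb, hlb⟩ := h b
  have htb : ∑ a, η a ^ 2 < (η t - η b) ^ 2 := by
    refine hij.trans_le ?_
    have := ht i; have := ht j; have := hb i; have := hb j
    nlinarith
  have h1 : ∃ i', ∑ a, η a ^ 2 < (η i' - η b) ^ 2 ∧ i' ≠ t := by
    rcases eq_or_eq_of_sum_sq_lt η hij htb with h | h | h | h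
    · exact absurd h hit
    · subst h; exact ⟨j, by rwa [← neg_sub, neg_sq], hjt⟩
    · exact absurd h hjt
    · subst h; exact ⟨i, hij, hit⟩
  have h2 : ∃ k', ∑ a, η a ^ 2 < (η t - η k') ^ 2 ∧ k' ≠ b := by
    rcases eq_or_eq_of_sum_sq_lt η hkl htb with h | h | h | h
    · subst h; exact ⟨l, hkl, hlb⟩
    · exact absurd h hkb
    · subst h; exact ⟨k, by rwa [← neg_sub, neg_sq], hkb⟩
    · exact absurd h hlb
  obtain ⟨i', hi', hi't⟩ := h1
  obtain ⟨k', hk', hk'b⟩ := h2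
  have hx : 0 ≤ ∑ a, η a ^ 2 := by positivity
  have htb' : t ≠ b := by rintro rfl; simp at htb; linarith
  rcases eq_or_eq_of_sum_sq_lt η hi' hk' with h | h | h | h
  · exact hi't h
  · subst h
    have := sq_add_sq_le_sum_sq η htb'
    have h3 := ht i'
    have h4 := hb i'
    nlinarith [sq_nonneg (η t + η b), mul_nonneg (sub_nonneg.2 h3) (sub_nonneg.2 h4)]
  · exact htb' h.symm
  · exact hk'b h.symm

/-- Lu's weighted inequality: only the pairs with `(η i - η j) ^ 2 > ∑ η ^ 2` contribute an excess
over `(∑ η ^ 2) * ∑ ρ`, and these form a star. The factor `2` counts `(i, j)` and `(j, i)`. -/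
lemma sum_sq_sub_mul_le [DecidableEq n] (η : n → ℝ) (ρ : n → n → ℝ) (R : ℝ)
    (hρ : ∀ i j, 0 ≤ ρ i j) (hR : ∀ i j, i ≠ j → ρ i j ≤ R) (hR0 : 0 ≤ R) :
    ∑ i, ∑ j, (η i - η j) ^ 2 * ρ i j ≤ (∑ i, η i ^ 2) * (∑ i, ∑ j, ρ i j + 2 * R) := by
  rcases isEmpty_or_nonempty n with hn | hn
  · simp
  set x := ∑ i, η i ^ 2 with hx
  have hx0 : 0 ≤ x := by positivity
  obtain ⟨c, hc⟩ := exists_center η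
  set φ : n → n → ℝ := fun i j => max ((η i - η j) ^ 2 - x) 0 with hφ
  have hφself : ∀ i, φ i i = 0 := fun i => by simp [hφ, hx0]
  have hφsymm : ∀ i j, φ i j = φ j i := fun i j => by
    simp only [hφ]; rw [← neg_sub (η j), neg_sq]
  have hφ0 : ∀ i j, 0 ≤ φ i j := fun i j => le_max_right _ _
  have hpt : ∀ i j, (η i - η j) ^ 2 * ρ i j ≤
      x * ρ i j + R * ((if i = c then φ c j else 0) + (if j = c then φ c i else 0)) := by
    intro i j
    have h1 : ((η i - η j) ^ 2 - x) * ρ i j ≤ R * φ i j := by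
      by_cases hij : i = j
      · subst hij
        rw [hφself]
        have := mul_nonneg hx0 (hρ i i)
        simp; linarith
      calc ((η i - η j) ^ 2 - x) * ρ i j ≤ φ i j * ρ i j :=
            mul_le_mul_of_nonneg_right (le_max_left _ _) (hρ i j)
        _ ≤ φ i j * R := mul_le_mul_of_nonneg_left (hR i j hij) (hφ0 i j)
        _ = R * φ i j := mul_comm _ _
    have h2 : φ i j ≤ (if i = c then φ c j else 0) + (if j = c then φ c i else 0) := by
      by_cases hb : x < (η i - η j) ^ 2
      · rcases hc i j hb with h | h
        · subst h; simp only [if_true]; split_ifs <;> linarith [hφ0 i i]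
        · subst h; simp only [if_true]; rw [hφsymm]; split_ifs <;> linarith [hφ0 j j]
      · have : φ i j = 0 := max_eq_right (by linarith)
        rw [this]
        split_ifs <;> linarith [hφ0 c i, hφ0 c j]
    have := mul_le_mul_of_nonneg_left h2 hR0
    linarith
  have hsum : ∑ j, φ c j ≤ x := by
    have h1 : ∑ j, φ c j = ∑ j ∈ Finset.univ.filter (fun j => x < (η c - η j) ^ 2),
        ((η c - η j) ^ 2 - x) := by
      rw [Finset.sum_filter]
      refine Finset.sum_congr rfl fun j _ => ?_
      simp only [hφ]
      split_ifs with h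
      · exact max_eq_left (by linarith)
      · exact max_eq_right (by linarith)
    have h2 := sum_sq_sub_le_of_star η c (Finset.univ.filter (fun j => x < (η c - η j) ^ 2))
      (by simp [hx0])
    rw [h1, Finset.sum_sub_distrib, Finset.sum_const, nsmul_eq_mul]
    linarith
  calc ∑ i, ∑ j, (η i - η j) ^ 2 * ρ i j
      ≤ ∑ i, ∑ j, (x * ρ i j + R * ((if i = c then φ c j else 0) + (if j = c then φ c i else 0))) :=
        Finset.sum_le_sum fun i _ => Finset.sum_le_sum fun j _ => hpt i j
    _ = x * ∑ i, ∑ j, ρ i j + 2 * R * ∑ j, φ c j := by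
        simp only [Finset.sum_add_distrib, ← Finset.mul_sum]
        have h1 : ∑ i, ∑ j, (if i = c then φ c j else 0) = ∑ j, φ c j := by
          rw [Finset.sum_comm]; simp
        have h2 : ∑ i, ∑ j, (if j = c then φ c i else 0) = ∑ j, φ c j := by simp
        rw [h1, h2]; ring
    _ ≤ x * (∑ i, ∑ j, ρ i j + 2 * R) := by nlinarith

/-- Bessel's inequality for the functional `X ↦ X i j` on symmetric matrices, whose squared norm
is `1 / 2` when `i ≠ j`. -/
lemma two_mul_sum_apply_sq_le [DecidableEq n] (s : Finset κ) (B : κ → Matrix n n ℝ)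
    (hB : ∀ k, (B k).IsSymm) (horth : ∀ k l, k ≠ l → frobeniusInner (B k) (B l) = 0)
    {y : ℝ} (hy0 : 0 ≤ y) (hy : ∀ k ∈ s, frobeniusSq (B k) ≤ y) {i j : n} (hij : i ≠ j) :
    2 * ∑ k ∈ s, B k i j ^ 2 ≤ y := by
  classical
  set c : κ → ℝ := fun k => if k ∈ s then B k i j else 0 with hc
  set X : Matrix n n ℝ := ∑ k, c k • B k with hX
  set ρ := ∑ k ∈ s, B k i j ^ 2 with hρ
  have hρ0 : 0 ≤ ρ := by positivity
  have hXij : X i j = ρ := by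
    rw [hX, Matrix.sum_apply, hρ, ← Finset.sum_subset (Finset.subset_univ s)]
    · exact Finset.sum_congr rfl fun k hk => by simp [hc, hk, sq]
    · intro k _ hk; simp [hc, hk]
  have hXji : X j i = X i j := by
    simp only [hX, Matrix.sum_apply, Matrix.smul_apply]
    exact Finset.sum_congr rfl fun k _ => by rw [(hB k).apply]
  have hXsq : frobeniusSq X ≤ y * ρ := by
    rw [← frobeniusInner_self]
    nth_rewrite 1 [hX]
    rw [frobeniusInner_sum_smul_left]
    have : ∀ k, c k * frobeniusInner (B k) X = c k ^ 2 * frobeniusSq (B k) := by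
      intro k
      rw [hX, frobeniusInner_sum_smul_right, Finset.sum_eq_single k, frobeniusInner_self]
      · ring
      · intro l _ hl; rw [horth k l hl.symm, mul_zero]
      · simp
    simp_rw [this]
    rw [hρ, Finset.mul_sum, ← Finset.sum_subset (Finset.subset_univ s)]
    · refine Finset.sum_le_sum fun k hk => ?_
      simp only [hc, hk, if_true]
      rw [mul_comm]
      exact mul_le_mul_of_nonneg_right (hy k hk) (sq_nonneg _)
    · intro k _ hk; simp [hc, hk]
  have h2 : 2 * ρ ^ 2 ≤ frobeniusSq X := by
    have h3 : ∑ q ∈ ({(i, j), (j, i)} : Finset (n × n)), X q.1 q.2 ^ 2 ≤ frobeniusSq X := by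
      rw [frobeniusSq, ← Fintype.sum_prod_type' (fun a b => X a b ^ 2)]
      exact Finset.sum_le_sum_of_subset_of_nonneg (Finset.subset_univ _) fun _ _ _ => sq_nonneg _
    rw [Finset.sum_pair (by simp [hij]), hXji, hXij] at h3
    linarith
  by_contra! h
  nlinarith

lemma frobeniusSq_commutator_diagonal [DecidableEq n] (η : n → ℝ) (B : Matrix n n ℝ) :
    frobeniusSq (diagonal η * B - B * diagonal η) = ∑ i, ∑ j, (η i - η j) ^ 2 * B i j ^ 2 := by
  simp only [frobeniusSq, Matrix.sub_apply, diagonal_mul, mul_diagonal]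
  exact Finset.sum_congr rfl fun _ _ => Finset.sum_congr rfl fun _ _ => by ring

lemma sum_commutator_diagonal_le [DecidableEq n] (s : Finset κ) (η : n → ℝ)
    (B : κ → Matrix n n ℝ) (hB : ∀ k, (B k).IsSymm)
    (horth : ∀ k l, k ≠ l → frobeniusInner (B k) (B l) = 0)
    {y : ℝ} (hy0 : 0 ≤ y) (hy : ∀ k ∈ s, frobeniusSq (B k) ≤ y) :
    ∑ k ∈ s, frobeniusSq (diagonal η * B k - B k * diagonal η) ≤
      frobeniusSq (diagonal η) * (∑ k ∈ s, frobeniusSq (B k) + y) := by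
  have h1 : frobeniusSq (diagonal η) = ∑ i, η i ^ 2 := by
    simp [frobeniusSq, diagonal_apply, ite_pow]
  have h2 := sum_sq_sub_mul_le η (fun i j => ∑ k ∈ s, B k i j ^ 2) (y / 2)
    (fun i j => by positivity)
    (fun i j hij => by linarith [two_mul_sum_apply_sq_le s B hB horth hy0 hy hij]) (by positivity)
  rw [h1]
  simp only [frobeniusSq_commutator_diagonal]
  convert h2 using 1
  · rw [Finset.sum_comm]
    refine Finset.sum_congr rfl fun i _ => ?_
    rw [Finset.sum_comm]
    simp [Finset.mul_sum]
  · congr 2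
    · simp only [frobeniusSq]
      rw [Finset.sum_comm]
      refine Finset.sum_congr rfl fun i _ => ?_
      rw [Finset.sum_comm]
    · ring

/-! ### Commutators and conjugation -/

/-- The squared Frobenius norm of the commutator of two matrices. -/
def commutatorSq (A B : Matrix n n ℝ) : ℝ := frobeniusSq (A * B - B * A)

lemma commutatorSq_self (A : Matrix n n ℝ) : commutatorSq A A = 0 := by
  simp [commutatorSq, frobeniusSq_zero]

lemma commutatorSq_comm (A B : Matrix n n ℝ) : commutatorSq A B = commutatorSq B A := by
  simp only [commutatorSq, frobeniusSq, Matrix.sub_apply]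
  exact Finset.sum_congr rfl fun _ _ => Finset.sum_congr rfl fun _ _ => by ring

lemma commutatorSq_smul_left (c : ℝ) (A B : Matrix n n ℝ) :
    commutatorSq (c • A) B = c ^ 2 * commutatorSq A B := by
  rw [commutatorSq, commutatorSq, ← frobeniusSq_smul, Matrix.smul_mul, Matrix.mul_smul, smul_sub]

lemma commutatorSq_smul_right (c : ℝ) (A B : Matrix n n ℝ) :
    commutatorSq A (c • B) = c ^ 2 * commutatorSq A B := by
  rw [commutatorSq_comm, commutatorSq_smul_left, commutatorSq_comm]

lemma frobeniusInner_eq_trace (A B : Matrix n n ℝ) : frobeniusInner A B = trace (A * Bᵀ) := by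
  simp [frobeniusInner, trace, mul_apply]

section Conjugation

variable {n' : Type*} [Fintype n'] [DecidableEq n] {C : Matrix n' n ℝ}

lemma trace_conj (hC : Cᵀ * C = 1) (A : Matrix n n ℝ) : trace (C * A * Cᵀ) = trace A := by
  rw [trace_mul_comm, ← Matrix.mul_assoc, hC, Matrix.one_mul]

lemma conj_mul_conj (hC : Cᵀ * C = 1) (A B : Matrix n n ℝ) :
    (C * A * Cᵀ) * (C * B * Cᵀ) = C * (A * B) * Cᵀ := by
  calc (C * A * Cᵀ) * (C * B * Cᵀ) = C * A * (Cᵀ * C) * B * Cᵀ := by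
        simp only [Matrix.mul_assoc]
    _ = _ := by rw [hC]; simp only [Matrix.mul_assoc, Matrix.one_mul]

lemma frobeniusInner_conj (hC : Cᵀ * C = 1) (A B : Matrix n n ℝ) :
    frobeniusInner (C * A * Cᵀ) (C * B * Cᵀ) = frobeniusInner A B := by
  have : (C * B * Cᵀ)ᵀ = C * Bᵀ * Cᵀ := by simp [Matrix.mul_assoc]
  rw [frobeniusInner_eq_trace, this, conj_mul_conj hC, trace_conj hC, frobeniusInner_eq_trace]

lemma frobeniusSq_conj (hC : Cᵀ * C = 1) (A : Matrix n n ℝ) :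
    frobeniusSq (C * A * Cᵀ) = frobeniusSq A := by
  rw [← frobeniusInner_self, frobeniusInner_conj hC, frobeniusInner_self]

lemma commutatorSq_conj (hC : Cᵀ * C = 1) (A B : Matrix n n ℝ) :
    commutatorSq (C * A * Cᵀ) (C * B * Cᵀ) = commutatorSq A B := by
  rw [commutatorSq, conj_mul_conj hC, conj_mul_conj hC, ← Matrix.sub_mul, ← Matrix.mul_sub,
    frobeniusSq_conj hC, commutatorSq]

end Conjugation

lemma exists_diagonal_conj [DecidableEq n] {A : Matrix n n ℝ} (hA : A.IsSymm) :
    ∃ (U : Matrix n n ℝ) (η : n → ℝ), Uᵀ * U = 1 ∧ U * Uᵀ = 1 ∧ A = U * diagonal η * Uᵀ := by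
  have hA' : A.IsHermitian := by rw [Matrix.IsHermitian, conjTranspose_eq_transpose_of_trivial, hA]
  refine ⟨hA'.eigenvectorUnitary, hA'.eigenvalues, ?_, ?_, ?_⟩
  · rw [← conjTranspose_eq_transpose_of_trivial]
    exact Unitary.coe_star_mul_self hA'.eigenvectorUnitary
  · rw [← conjTranspose_eq_transpose_of_trivial]
    exact Unitary.coe_mul_star_self hA'.eigenvectorUnitary
  · rw [← conjTranspose_eq_transpose_of_trivial]
    conv_lhs => rw [hA'.spectral_theorem]
    rfl

/-- Lu's inequality: the commutators of a symmetric matrix `A` with an orthogonal family `B` of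
symmetric matrices of squared norm at most `y`. -/
lemma sum_commutatorSq_le [DecidableEq n] (s : Finset κ) {A : Matrix n n ℝ} (hA : A.IsSymm)
    {B : κ → Matrix n n ℝ} (hB : ∀ k, (B k).IsSymm)
    (horth : ∀ k l, k ≠ l → frobeniusInner (B k) (B l) = 0)
    {y : ℝ} (hy0 : 0 ≤ y) (hy : ∀ k ∈ s, frobeniusSq (B k) ≤ y) :
    ∑ k ∈ s, commutatorSq A (B k) ≤ frobeniusSq A * (∑ k ∈ s, frobeniusSq (B k) + y) := by
  obtain ⟨U, η, hU, hU', rfl⟩ := exists_diagonal_conj hA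
  obtain ⟨B', rfl⟩ : ∃ B' : κ → Matrix n n ℝ, B = fun k => U * B' k * Uᵀ := by
    refine ⟨fun k => Uᵀ * B k * U, funext fun k => ?_⟩
    calc B k = (U * Uᵀ) * B k * (U * Uᵀ) := by rw [hU']; simp
      _ = _ := by simp only [Matrix.mul_assoc]
  simp only [frobeniusInner_conj hU] at horth
  simp only [frobeniusSq_conj hU, commutatorSq_conj hU] at hy ⊢
  refine sum_commutator_diagonal_le s η B' (fun k => ?_) horth hy0 hy
  have h1 : U * (B' k)ᵀ * Uᵀ = U * B' k * Uᵀ := by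
    have := (hB k).eq
    simpa [Matrix.mul_assoc] using this
  calc (B' k)ᵀ = (Uᵀ * U) * (B' k)ᵀ * (Uᵀ * U) := by rw [hU]; simp
    _ = Uᵀ * (U * (B' k)ᵀ * Uᵀ) * U := by simp only [Matrix.mul_assoc]
    _ = (Uᵀ * U) * B' k * (Uᵀ * U) := by rw [h1]; simp only [Matrix.mul_assoc]
    _ = B' k := by rw [hU]; simp

section Rotation

variable [DecidableEq κ] {U : Matrix κ κ ℝ}

/-- The total squared norm of a family is invariant under orthogonal recombination. -/
lemma sum_frobeniusSq_rotate (hU : U * Uᵀ = 1) (X : κ → Matrix n n ℝ) :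
    ∑ k, frobeniusSq (∑ a, U a k • X a) = ∑ a, frobeniusSq (X a) := by
  have h1 : ∀ a b, ∑ k, U a k * U b k = if a = b then 1 else 0 := fun a b => by
    have := congrFun (congrFun hU a) b
    simpa [mul_apply, one_apply] using this
  simp_rw [← frobeniusInner_self, frobeniusInner_sum_smul_left, frobeniusInner_sum_smul_right,
    Finset.mul_sum]
  rw [Finset.sum_comm]
  refine Finset.sum_congr rfl fun a _ => ?_
  rw [Finset.sum_comm]
  simp_rw [← mul_assoc, ← Finset.sum_mul, h1]
  simp

lemma sum_commutatorSq_rotate (hU : U * Uᵀ = 1) (X : κ → Matrix n n ℝ) :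
    ∑ k, ∑ l, commutatorSq (∑ a, U a k • X a) (∑ a, U a l • X a)
      = ∑ a, ∑ b, commutatorSq (X a) (X b) := by
  have key : ∀ Y : Matrix n n ℝ,
      ∑ l, commutatorSq Y (∑ a, U a l • X a) = ∑ b, commutatorSq Y (X b) := by
    intro Y
    simp only [commutatorSq]
    rw [← sum_frobeniusSq_rotate hU fun b => Y * X b - X b * Y]
    refine Finset.sum_congr rfl fun l _ => ?_
    congr 1
    simp only [Matrix.mul_sum, Matrix.sum_mul, Matrix.mul_smul, Matrix.smul_mul, smul_sub,
      Finset.sum_sub_distrib]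
  simp_rw [key]
  rw [Finset.sum_comm]
  refine Finset.sum_congr rfl fun b _ => ?_
  rw [Finset.sum_congr rfl fun k _ => commutatorSq_comm _ _, key]

/-- An orthogonal recombination makes the family pairwise orthogonal: diagonalize its Gram
matrix. -/
lemma exists_orthogonal_rotation (X : κ → Matrix n n ℝ) :
    ∃ U : Matrix κ κ ℝ, U * Uᵀ = 1 ∧
      ∀ k l, k ≠ l → frobeniusInner (∑ a, U a k • X a) (∑ a, U a l • X a) = 0 := by
  have hG : (Matrix.of fun a b => frobeniusInner (X a) (X b)).IsSymm :=
    Matrix.IsSymm.ext fun a b => by simp [frobeniusInner_comm]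
  obtain ⟨U, η, hU, hU', h⟩ := exists_diagonal_conj hG
  refine ⟨U, hU', fun k l hkl => ?_⟩
  have h1 : Uᵀ * (Matrix.of fun a b => frobeniusInner (X a) (X b)) * U = diagonal η := by
    calc _ = (Uᵀ * U) * diagonal η * (Uᵀ * U) := by rw [h]; simp only [Matrix.mul_assoc]
      _ = _ := by rw [hU]; simp
  have h2 := congrFun (congrFun h1 k) l
  rw [diagonal_apply_ne _ hkl] at h2
  rw [← h2, frobeniusInner_sum_smul_left]
  simp_rw [frobeniusInner_sum_smul_right]
  simp only [mul_apply, transpose_apply, of_apply, Finset.mul_sum, Finset.sum_mul]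
  rw [Finset.sum_comm]
  exact Finset.sum_congr rfl fun _ _ => Finset.sum_congr rfl fun _ _ => by ring

end Rotation

/-- By compactness of the unit sphere, the commutator sum attains its maximum on the families of
symmetric matrices of total squared norm one. -/
lemma exists_maximizer [Nonempty κ] [Nonempty n] :
    ∃ A : κ → Matrix n n ℝ, (∀ a, (A a).IsSymm) ∧ ∑ a, frobeniusSq (A a) = 1 ∧
      ∀ B : κ → Matrix n n ℝ, (∀ a, (B a).IsSymm) → ∑ a, frobeniusSq (B a) = 1 →
        ∑ a, ∑ b, commutatorSq (B a) (B b) ≤ ∑ a, ∑ b, commutatorSq (A a) (A b) := by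
  classical
  set K : Set (κ → n → n → ℝ) :=
    {A | (∀ a i j, A a j i = A a i j) ∧ ∑ a, ∑ i, ∑ j, A a i j ^ 2 = 1} with hK
  have hcl : IsClosed K := by
    refine IsClosed.inter ?_ (isClosed_eq (by fun_prop) continuous_const)
    have : {A : κ → n → n → ℝ | ∀ a i j, A a j i = A a i j}
        = ⋂ (a) (i) (j), {A | A a j i = A a i j} := by ext A; simp
    change IsClosed {A : κ → n → n → ℝ | ∀ a i j, A a j i = A a i j}
    rw [this]
    exact isClosed_iInter fun a => isClosed_iInter fun i => isClosed_iInter fun j =>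
      isClosed_eq (by fun_prop) (by fun_prop)
  have hcpt : IsCompact K := by
    refine (isCompact_univ_pi fun _ : κ => isCompact_univ_pi fun _ : n => isCompact_univ_pi
      fun _ : n => isCompact_Icc (a := (-1 : ℝ)) (b := 1)).of_isClosed_subset hcl ?_
    rintro A ⟨-, hA⟩
    simp only [Set.mem_pi, Set.mem_univ, true_imp_iff]
    intro a i j
    rw [Set.mem_Icc, ← abs_le, ← sq_le_one_iff_abs_le_one, ← hA]
    refine le_trans ?_ (Finset.single_le_sum (f := fun a => ∑ i, ∑ j, A a i j ^ 2)
      (fun _ _ => by positivity) (Finset.mem_univ a))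
    refine le_trans ?_ (Finset.single_le_sum (f := fun i => ∑ j, A a i j ^ 2)
      (fun _ _ => by positivity) (Finset.mem_univ i))
    exact Finset.single_le_sum (f := fun j => A a i j ^ 2)
      (fun _ _ => by positivity) (Finset.mem_univ j)
  have hne : K.Nonempty := by
    obtain ⟨a₀⟩ := ‹Nonempty κ›
    obtain ⟨i₀⟩ := ‹Nonempty n›
    refine ⟨fun a i j => if a = a₀ ∧ i = i₀ ∧ j = i₀ then 1 else 0, fun a i j => ?_, ?_⟩
    · simp only [and_comm (a := j = i₀)]
    · simp [ite_and, ite_pow]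
  obtain ⟨A, ⟨hA1, hA2⟩, hA⟩ := hcpt.exists_isMaxOn hne
    (f := fun A : κ → n → n → ℝ => ∑ a, ∑ b, commutatorSq (Matrix.of (A a)) (Matrix.of (A b)))
    (by
      refine Continuous.continuousOn ?_
      simp only [commutatorSq, frobeniusSq, Matrix.sub_apply, Matrix.mul_apply, Matrix.of_apply]
      fun_prop)
  refine ⟨fun a => Matrix.of (A a), fun a => Matrix.IsSymm.ext fun i j => hA1 a i j, hA2, ?_⟩
  intro B hB1 hB2
  exact hA (show (B : κ → n → n → ℝ) ∈ K from ⟨fun a i j => (hB1 a).apply i j, hB2⟩)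

lemma sum_commutatorSq_update_smul [DecidableEq κ] (A : κ → Matrix n n ℝ) (k : κ) (s : ℝ) :
    ∑ a, ∑ b, commutatorSq (Function.update A k (s • A k) a) (Function.update A k (s • A k) b)
      = ∑ a, ∑ b, commutatorSq (A a) (A b) + 2 * (s ^ 2 - 1) * ∑ b, commutatorSq (A k) (A b) := by
  have h1 : ∀ F : κ → κ → ℝ, F k k = 0 → (∀ a b, F a b = F b a) → ∑ a, ∑ b, F a b =
      2 * ∑ b, F k b + ∑ a ∈ Finset.univ.erase k, ∑ b ∈ Finset.univ.erase k, F a b := by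
    intro F hF0 hF
    rw [← Finset.add_sum_erase _ _ (Finset.mem_univ k)]
    simp_rw [← Finset.add_sum_erase Finset.univ (F _) (Finset.mem_univ k),
      Finset.sum_add_distrib, hF _ k, hF0]
    ring
  rw [h1 _ (commutatorSq_self _) (fun _ _ => commutatorSq_comm _ _),
    h1 (fun a b => commutatorSq (A a) (A b)) (commutatorSq_self _)
      (fun _ _ => commutatorSq_comm _ _)]
  have h2 : ∑ a ∈ Finset.univ.erase k, ∑ b ∈ Finset.univ.erase k,
      commutatorSq (Function.update A k (s • A k) a) (Function.update A k (s • A k) b)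
      = ∑ a ∈ Finset.univ.erase k, ∑ b ∈ Finset.univ.erase k, commutatorSq (A a) (A b) := by
    refine Finset.sum_congr rfl fun a ha => Finset.sum_congr rfl fun b hb => ?_
    rw [Function.update_of_ne (Finset.ne_of_mem_erase ha),
      Function.update_of_ne (Finset.ne_of_mem_erase hb)]
  have h3 : ∑ b, commutatorSq (Function.update A k (s • A k) k) (Function.update A k (s • A k) b)
      = s ^ 2 * ∑ b, commutatorSq (A k) (A b) := by
    rw [Finset.mul_sum]
    refine Finset.sum_congr rfl fun b _ => ?_
    rw [Function.update_self, commutatorSq_smul_left]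
    by_cases hb : b = k
    · subst hb
      rw [Function.update_self, commutatorSq_smul_right, commutatorSq_self]; simp
    · rw [Function.update_of_ne hb]
  rw [h2, h3]; ring

lemma sum_frobeniusSq_update_smul [DecidableEq κ] (A : κ → Matrix n n ℝ) (k : κ) (s : ℝ) :
    ∑ a, frobeniusSq (Function.update A k (s • A k) a)
      = ∑ a, frobeniusSq (A a) + (s ^ 2 - 1) * frobeniusSq (A k) := by
  rw [← Finset.add_sum_erase _ _ (Finset.mem_univ k),
    ← Finset.add_sum_erase (a := k) Finset.univ (fun a => frobeniusSq (A a)) (Finset.mem_univ k),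
    Function.update_self, frobeniusSq_smul]
  have : ∑ a ∈ Finset.univ.erase k, frobeniusSq (Function.update A k (s • A k) a)
      = ∑ a ∈ Finset.univ.erase k, frobeniusSq (A a) :=
    Finset.sum_congr rfl fun a ha => by rw [Function.update_of_ne (Finset.ne_of_mem_erase ha)]
  rw [this]; ring

/-- A bound on the unit sphere extends to all families, since the commutator sum is homogeneous
of degree four. -/
lemma sum_commutatorSq_le_mul_sq {M : ℝ}
    (hM : ∀ B : κ → Matrix n n ℝ, (∀ a, (B a).IsSymm) → ∑ a, frobeniusSq (B a) = 1 →
      ∑ a, ∑ b, commutatorSq (B a) (B b) ≤ M)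
    (B : κ → Matrix n n ℝ) (hB : ∀ a, (B a).IsSymm) :
    ∑ a, ∑ b, commutatorSq (B a) (B b) ≤ M * (∑ a, frobeniusSq (B a)) ^ 2 := by
  set S := ∑ a, frobeniusSq (B a) with hS
  have hS0 : 0 ≤ S := Finset.sum_nonneg fun _ _ => frobeniusSq_nonneg _
  rcases hS0.eq_or_lt with h0 | h0
  · have h1 : ∀ a, B a = 0 := fun a => eq_zero_of_frobeniusSq_eq_zero
      ((Finset.sum_eq_zero_iff_of_nonneg fun _ _ => frobeniusSq_nonneg _).1 h0.symm a
        (Finset.mem_univ a))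
    simp [h1, ← h0, commutatorSq_self]
  · have hs : (√S)⁻¹ ^ 2 = S⁻¹ := by rw [inv_pow, Real.sq_sqrt hS0]
    have h1 := hM (fun a => (√S)⁻¹ • B a) (fun a => (hB a).smul _) (by
      simp only [frobeniusSq_smul, ← Finset.mul_sum, hs]
      exact inv_mul_cancel₀ h0.ne')
    simp only [commutatorSq_smul_left, commutatorSq_smul_right, ← Finset.mul_sum, hs] at h1
    rw [← mul_assoc, ← mul_inv, inv_mul_le_iff₀ (by positivity)] at h1
    linarith

/-- The algebraic DDVV inequality (Lu, Ge–Tang), for families of symmetric matrices with arbitrary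
traces. A maximizer `A` on the unit sphere, of value `M`, may be taken orthogonal. With `A k` its
longest member, the first variation under scaling of `A k` bounds `M * ‖A k‖²` by
`∑ l, ‖[A k, A l]‖²`, which is at most `‖A k‖²` by `sum_commutatorSq_le`; hence `M ≤ 1`. -/
theorem sum_commutatorSq_le_sq (B : κ → Matrix n n ℝ) (hB : ∀ a, (B a).IsSymm) :
    ∑ a, ∑ b, commutatorSq (B a) (B b) ≤ (∑ a, frobeniusSq (B a)) ^ 2 := by
  classical
  rcases isEmpty_or_nonempty κ with hκ | hκ
  · simp
  rcases isEmpty_or_nonempty n with hn | hn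
  · simp [commutatorSq, frobeniusSq]
  obtain ⟨A₀, hA₀, hA₀1, hmax⟩ := exists_maximizer (n := n) (κ := κ)
  set M := ∑ a, ∑ b, commutatorSq (A₀ a) (A₀ b) with hMdef
  have hM := sum_commutatorSq_le_mul_sq hmax
  suffices M ≤ 1 from (hM B hB).trans (mul_le_of_le_one_left (sq_nonneg _) this)
  obtain ⟨U, hU, horth⟩ := exists_orthogonal_rotation A₀
  set A : κ → Matrix n n ℝ := fun k => ∑ a, U a k • A₀ a with hAdef
  have hA : ∀ k, (A k).IsSymm := fun k => by
    simp only [hAdef, Matrix.IsSymm, transpose_sum, transpose_smul, (hA₀ _).eq]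
  have hA1 : ∑ k, frobeniusSq (A k) = 1 := by
    rw [← hA₀1, ← sum_frobeniusSq_rotate hU A₀]
  have hAM : ∑ k, ∑ l, commutatorSq (A k) (A l) = M := sum_commutatorSq_rotate hU A₀
  obtain ⟨k, hk⟩ := Finite.exists_max fun k => frobeniusSq (A k)
  set x := frobeniusSq (A k) with hx
  have hx1 : x ≤ 1 := by
    rw [← hA1]
    exact Finset.single_le_sum (f := fun k => frobeniusSq (A k))
      (fun _ _ => frobeniusSq_nonneg _) (Finset.mem_univ k)
  have hx0 : 0 < x := by
    by_contra! h
    have : ∑ k, frobeniusSq (A k) ≤ 0 := Finset.sum_nonpos fun a _ => (hk a).trans h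
    linarith
  set P := ∑ l, commutatorSq (A k) (A l) with hP
  have hPx : P ≤ x := by
    have h1 := sum_commutatorSq_le (Finset.univ.erase k) (hA k) hA horth hx0.le
      (fun l _ => hk l)
    rw [hP, ← Finset.add_sum_erase _ _ (Finset.mem_univ k), commutatorSq_self, zero_add]
    rw [← Finset.add_sum_erase _ _ (Finset.mem_univ k)] at hA1
    refine h1.trans_eq ?_
    rw [add_comm, hA1, mul_one]
  -- first variation of the commutator sum under scaling of the longest matrix `A k`
  have hvar : ∀ ε : ℝ, 0 ≤ ε → ε ≤ 1 → M - 2 * ε * P ≤ M * (1 - ε * x) ^ 2 := by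
    intro ε h0 h1
    have h2 := hM (Function.update A k (√(1 - ε) • A k)) (fun a => by
      by_cases ha : a = k
      · subst ha; rw [Function.update_self]; exact (hA a).smul _
      · rw [Function.update_of_ne ha]; exact hA a)
    rw [sum_commutatorSq_update_smul, sum_frobeniusSq_update_smul, hAM, hA1,
      Real.sq_sqrt (by linarith)] at h2
    calc M - 2 * ε * P = M + 2 * (1 - ε - 1) * P := by ring
      _ ≤ _ := h2
      _ = _ := by ring
  clear_value M x P
  by_contra! hM1
  have hM0 : 0 < M := by linarith
  -- any small `ε` would do; this one satisfies `ε * M = M - 1`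
  have h3 := hvar ((M - 1) / M) (div_nonneg (by linarith) hM0.le) ((div_le_one hM0).2 (by linarith))
  set ε := (M - 1) / M with hε
  have hεM : ε * M = M - 1 := div_mul_cancel₀ _ hM0.ne'
  have hε0 : 0 < ε := div_pos (by linarith) hM0
  have h4 : M * (2 - ε * x) * (ε * x) ≤ 2 * (ε * x) := by
    have := mul_le_mul_of_nonneg_left hPx hε0.le
    linarith
  have h5 : M * (2 - ε * x) ≤ 2 := le_of_mul_le_mul_right h4 (by positivity)
  have h6 : M * (2 - ε * x) = 2 * M - (M - 1) * x := by rw [← hεM]; ring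
  have h7 : (M - 1) * x ≤ (M - 1) * 1 := mul_le_mul_of_nonneg_left hx1 (by linarith)
  linarith

end DDVV

/-! ### Smooth immersions and the Gram matrix -/

section SmoothImmersions

variable {E : Type*} [NormedAddCommGroup E] [NormedSpace ℝ E]
  {V : Type*} [NormedAddCommGroup V] [NormedSpace ℝ V]

/-- The iterated derivative `D_v D_w F` at `y` in the constant directions `v`, `w`. -/
noncomputable def secondDeriv (F : E → V) (y v w : E) : V :=
  fderiv ℝ (fun q => fderiv ℝ F q w) y v

lemma ContDiffAt.fderiv_apply_const {F : E → V} {y : E} (hF : ContDiffAt ℝ ∞ F y) (w : E) :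
    ContDiffAt ℝ ∞ (fun q => fderiv ℝ F q w) y :=
  (hF.fderiv_right (by simp)).clm_apply contDiffAt_const

lemma ContDiffAt.differentiableAt_infty {F : E → V} {y : E} (hF : ContDiffAt ℝ ∞ F y) :
    DifferentiableAt ℝ F y :=
  hF.differentiableAt (by simp)

lemma fderiv_fderiv_eq_secondDeriv {F : E → V} {y : E} (hF : ContDiffAt ℝ ∞ F y) (v w : E) :
    fderiv ℝ (fderiv ℝ F) y v w = secondDeriv F y v w := by
  rw [secondDeriv, fderiv_clm_apply
    (hF.fderiv_right (m := ∞) (by simp)).differentiableAt_infty (differentiableAt_const w)]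
  simp

lemma secondDeriv_comm {F : E → V} {y : E} (hF : ContDiffAt ℝ ∞ F y) (v w : E) :
    secondDeriv F y v w = secondDeriv F y w v := by
  rw [← fderiv_fderiv_eq_secondDeriv hF, ← fderiv_fderiv_eq_secondDeriv hF]
  exact (hF.isSymmSndFDerivAt (by simpa using WithTop.coe_le_coe.2 (le_top : (2 : ℕ∞) ≤ ⊤))).eq v w

lemma secondDeriv_sum_smul {F : E → V} {y : E} (hF : ContDiffAt ℝ ∞ F y) {ι : Type*}
    [Fintype ι] (c d : ι → ℝ) (e : ι → E) :
    secondDeriv F y (∑ k, c k • e k) (∑ l, d l • e l)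
      = ∑ k, ∑ l, (c k * d l) • secondDeriv F y (e k) (e l) := by
  simp only [← fderiv_fderiv_eq_secondDeriv hF, map_sum, map_smul,
    _root_.sum_apply, _root_.smul_apply, smul_smul, Finset.smul_sum]
  rw [Finset.sum_comm]
  exact Finset.sum_congr rfl fun _ _ => Finset.sum_congr rfl fun _ _ => by rw [mul_comm]

/-- `F` is smooth near `y`, and its differential at `y` is injective. -/
structure IsSmoothImmersionAt (F : E → V) (y : E) : Prop where
  eventually_contDiffAt : ∀ᶠ q in 𝓝 y, ContDiffAt ℝ ∞ F q
  injective : Function.Injective (fderiv ℝ F y)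

lemma IsSmoothImmersionAt.contDiffAt {F : E → V} {y : E} (h : IsSmoothImmersionAt F y) :
    ContDiffAt ℝ ∞ F y := h.eventually_contDiffAt.self_of_nhds

end SmoothImmersions

section GramMatrix

lemma ContDiffAt.matrix_det {X : Type*} [NormedAddCommGroup X] [NormedSpace ℝ X]
    {n : Type*} [Fintype n] [DecidableEq n] {A : X → Matrix n n ℝ} {y : X} {k : ℕ∞ω}
    (h : ∀ i j, ContDiffAt ℝ k (fun q => A q i j) y) : ContDiffAt ℝ k (fun q => (A q).det) y := by
  simp only [Matrix.det_apply']
  exact ContDiffAt.sum fun σ _ => contDiffAt_const.mul (contDiffAt_prod fun i _ => h _ _)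

lemma ContDiffAt.matrix_inv_apply {X : Type*} [NormedAddCommGroup X] [NormedSpace ℝ X]
    {n : Type*} [Fintype n] [DecidableEq n] {A : X → Matrix n n ℝ} {y : X} {k : ℕ∞ω}
    (h : ∀ i j, ContDiffAt ℝ k (fun q => A q i j) y) (hdet : (A y).det ≠ 0) (i j : n) :
    ContDiffAt ℝ k (fun q => (A q)⁻¹ i j) y := by
  simp only [Matrix.inv_def, Matrix.smul_apply, Matrix.adjugate_apply, Ring.inverse_eq_inv',
    smul_eq_mul]
  refine ((ContDiffAt.matrix_det h).inv hdet).mul (ContDiffAt.matrix_det fun a b => ?_)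
  by_cases ha : a = j
  · subst ha; simp only [Matrix.updateRow_self]; exact contDiffAt_const
  · simp only [Matrix.updateRow_ne ha]; exact h a b

variable {E : Type*} [NormedAddCommGroup E] [NormedSpace ℝ E] [FiniteDimensional ℝ E]
  {V : Type*} [NormedAddCommGroup V] [InnerProductSpace ℝ V]
  {F : E → V} {y : E}

/-- The metric is nondegenerate exactly where `F` is an immersion, so that the inverse in
`christoffel` is a genuine inverse there. -/
lemma det_gramMatrix_ne_zero_iff :
    (gramMatrix (firstFundamentalForm F) y).det ≠ 0 ↔ Function.Injective (fderiv ℝ F y) := by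
  have hker : (∃ c ≠ 0, (gramMatrix (firstFundamentalForm F) y).mulVec c = 0) ↔
      ∃ v ≠ 0, fderiv ℝ F y v = 0 := by
    constructor
    · rintro ⟨c, hc, h⟩
      refine ⟨∑ i, c i • Module.finBasis ℝ E i, fun h0 => hc ?_, ?_⟩
      · exact funext fun i => Fintype.linearIndependent_iff.1
          (Module.finBasis ℝ E).linearIndependent c h0 i
      · have h1 : c ⬝ᵥ (gramMatrix (firstFundamentalForm F) y).mulVec c = 0 := by rw [h]; simp
        rw [← inner_self_eq_zero (𝕜 := ℝ), ← h1]
        simp only [map_sum, map_smul, sum_inner, inner_sum, inner_smul_left, inner_smul_right,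
          dotProduct, Matrix.mulVec, gramMatrix, Matrix.of_apply, firstFundamentalForm,
          Finset.mul_sum]
        refine Finset.sum_congr rfl fun i _ => Finset.sum_congr rfl fun j _ => ?_
        rw [real_inner_comm, conj_trivial]; ring
    · rintro ⟨v, hv, h⟩
      refine ⟨(Module.finBasis ℝ E).equivFun v, by simpa using hv, ?_⟩
      ext i
      have h1 : ⟪fderiv ℝ F y (Module.finBasis ℝ E i), fderiv ℝ F y v⟫_ℝ = 0 := by rw [h]; simp
      rw [← congrArg (fderiv ℝ F y) ((Module.finBasis ℝ E).sum_equivFun v)] at h1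
      simp only [map_sum, map_smul, inner_sum, inner_smul_right] at h1
      rw [Pi.zero_apply, ← h1]
      simp only [Matrix.mulVec, dotProduct, gramMatrix, Matrix.of_apply, firstFundamentalForm]
      exact Finset.sum_congr rfl fun j _ => mul_comm _ _
  rw [Ne, ← Matrix.exists_mulVec_eq_zero_iff, hker, injective_iff_map_eq_zero]
  push Not
  exact forall_congr' fun v => ⟨fun h h' => by_contra fun h0 => h h0 h', fun h h0 h' => h0 (h h')⟩

lemma contDiffAt_gramMatrix (hF : ContDiffAt ℝ ∞ F y) (i j) :
    ContDiffAt ℝ ∞ (fun q => gramMatrix (firstFundamentalForm F) q i j) y :=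
  (hF.fderiv_apply_const _).inner ℝ (hF.fderiv_apply_const _)

lemma IsSmoothImmersionAt.contDiffAt_gramMatrix_inv (h : IsSmoothImmersionAt F y) (i j) :
    ContDiffAt ℝ ∞ (fun q => (gramMatrix (firstFundamentalForm F) q)⁻¹ i j) y :=
  ContDiffAt.matrix_inv_apply (contDiffAt_gramMatrix h.contDiffAt)
    (det_gramMatrix_ne_zero_iff.2 h.injective) i j

/-- Being an immersion is an open condition. -/
lemma IsSmoothImmersionAt.eventually (h : IsSmoothImmersionAt F y) :
    ∀ᶠ q in 𝓝 y, IsSmoothImmersionAt F q := by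
  have h1 : ∀ᶠ q in 𝓝 y, (gramMatrix (firstFundamentalForm F) q).det ≠ 0 :=
    (ContDiffAt.matrix_det (contDiffAt_gramMatrix h.contDiffAt)).continuousAt.eventually_ne
      (det_gramMatrix_ne_zero_iff.2 h.injective)
  filter_upwards [h1, h.eventually_contDiffAt.eventually_nhds] with q hq hq'
  exact ⟨hq', det_gramMatrix_ne_zero_iff.1 hq⟩

/-- Raising an index with the inverse Gram matrix turns the functional `a` into the vector that
represents it for the induced metric. -/
lemma inner_fderiv_gramMatrix_inv_sum (hinj : Function.Injective (fderiv ℝ F y))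
    (a : E →ₗ[ℝ] ℝ) (z : E) :
    ⟪fderiv ℝ F y (∑ k, ∑ l, ((gramMatrix (firstFundamentalForm F) y)⁻¹ k l *
      a (Module.finBasis ℝ E l)) • Module.finBasis ℝ E k), fderiv ℝ F y z⟫_ℝ = a z := by
  set b := Module.finBasis ℝ E
  set G := gramMatrix (firstFundamentalForm F) y with hG
  have hdet : IsUnit G.det := isUnit_iff_ne_zero.2 (det_gramMatrix_ne_zero_iff.2 hinj)
  have hbasis : ∀ j, ⟪fderiv ℝ F y (∑ k, ∑ l, (G⁻¹ k l * a (b l)) • b k),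
      fderiv ℝ F y (b j)⟫_ℝ = a (b j) := by
    intro j
    have h1 : ∀ k, ⟪fderiv ℝ F y (b k), fderiv ℝ F y (b j)⟫_ℝ = G j k := fun k =>
      real_inner_comm _ _
    simp only [map_sum, map_smul, sum_inner, inner_smul_left, h1]
    rw [Finset.sum_comm]
    have h2 : ∀ l, ∑ k, (G⁻¹ k l * a (b l)) * G j k = (if j = l then 1 else 0) * a (b l) := by
      intro l
      have := congrFun (congrFun (Matrix.mul_nonsing_inv G hdet) j) l
      rw [Matrix.mul_apply, Matrix.one_apply] at this
      rw [← this, Finset.sum_mul]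
      exact Finset.sum_congr rfl fun k _ => by ring
    simp only [conj_trivial, h2]
    simp
  conv_lhs => rw [← b.sum_repr z]
  conv_rhs => rw [← b.sum_repr z]
  simp only [map_sum (fderiv ℝ F y) (fun i => b.repr z i • b i), map_smul, inner_sum,
    inner_smul_right, hbasis, map_sum a, smul_eq_mul]

end GramMatrix

/-! ### The Gauss equation -/

section Gauss

variable {E : Type*} [NormedAddCommGroup E] [NormedSpace ℝ E]
  {V : Type*} [NormedAddCommGroup V] [InnerProductSpace ℝ V]
  {F : E → V} {y : E}

lemma christoffelFirst_firstFundamentalForm (hF : ContDiffAt ℝ ∞ F y) (v w z : E) :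
    christoffelFirst (firstFundamentalForm F) y v w z
      = ⟪secondDeriv F y v w, fderiv ℝ F y z⟫_ℝ := by
  have h1 : ∀ a b c, fderiv ℝ (fun q => firstFundamentalForm F q a b) y c
      = ⟪fderiv ℝ F y a, secondDeriv F y c b⟫_ℝ + ⟪secondDeriv F y c a, fderiv ℝ F y b⟫_ℝ :=
    fun a b c => fderiv_inner_apply ℝ (hF.fderiv_apply_const a).differentiableAt_infty
      (hF.fderiv_apply_const b).differentiableAt_infty c
  simp only [christoffelFirst, h1]
  rw [secondDeriv_comm hF w v, secondDeriv_comm hF w z, secondDeriv_comm hF v z,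
    real_inner_comm _ (fderiv ℝ F y w)]
  ring

variable [FiniteDimensional ℝ E]

/-- `dF (∇_v w)` and `D_v D_w F` have the same tangential part. -/
lemma IsSmoothImmersionAt.inner_christoffel (h : IsSmoothImmersionAt F y) (v w z : E) :
    ⟪fderiv ℝ F y (christoffel (firstFundamentalForm F) y v w), fderiv ℝ F y z⟫_ℝ
      = ⟪secondDeriv F y v w, fderiv ℝ F y z⟫_ℝ := by
  simp only [christoffel, christoffelFirst_firstFundamentalForm h.contDiffAt]
  exact inner_fderiv_gramMatrix_inv_sum h.injective
    ((innerSL ℝ (secondDeriv F y v w)).toLinearMap ∘ₗ (fderiv ℝ F y).toLinearMap) z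

lemma IsSmoothImmersionAt.differentiableAt_christoffel (h : IsSmoothImmersionAt F y) (v w : E) :
    DifferentiableAt ℝ (fun q => christoffel (firstFundamentalForm F) q v w) y := by
  have h1 : ∀ l, DifferentiableAt ℝ (fun q => christoffelFirst (firstFundamentalForm F) q v w
      (Module.finBasis ℝ E l)) y := by
    intro l
    have h2 : (fun q => christoffelFirst (firstFundamentalForm F) q v w (Module.finBasis ℝ E l))
        =ᶠ[𝓝 y] fun q => ⟪secondDeriv F q v w, fderiv ℝ F q (Module.finBasis ℝ E l)⟫_ℝ :=
      h.eventually_contDiffAt.mono fun q hq => christoffelFirst_firstFundamentalForm hq v w _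
    rw [h2.differentiableAt_iff]
    exact ((h.contDiffAt.fderiv_apply_const w).fderiv_apply_const v).differentiableAt_infty.inner ℝ
      (h.contDiffAt.fderiv_apply_const _).differentiableAt_infty
  unfold christoffel
  refine DifferentiableAt.fun_sum fun k _ => DifferentiableAt.fun_sum fun l _ => ?_
  exact ((h.contDiffAt_gramMatrix_inv k l).differentiableAt_infty.mul (h1 l)).smul_const _

/-- One half of the Gauss equation, before skew-symmetrization in `v` and `w`: it is the derivative
in the direction `v` of the identity `inner_christoffel` for `∇_w z`. -/
lemma IsSmoothImmersionAt.inner_leviCivita_leviCivita (h : IsSmoothImmersionAt F y)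
    (v w z t : E) :
    ⟪fderiv ℝ F y (leviCivita (firstFundamentalForm F) v
        (leviCivita (firstFundamentalForm F) w fun _ => z) y), fderiv ℝ F y t⟫_ℝ
      = ⟪secondDeriv (fun q => fderiv ℝ F q z) y v w, fderiv ℝ F y t⟫_ℝ
        + ⟪secondDeriv F y w z - fderiv ℝ F y (christoffel (firstFundamentalForm F) y w z),
          secondDeriv F y v t⟫_ℝ := by
  set Y : E → E := fun q => christoffel (firstFundamentalForm F) q w z with hY
  have hYeq : (leviCivita (firstFundamentalForm F) w fun _ => z) = Y := by
    ext q; simp [leviCivita, hY]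
  have hYd : HasFDerivAt Y (fderiv ℝ Y y) y := (h.differentiableAt_christoffel w z).hasFDerivAt
  have hF := h.contDiffAt
  have hdF : DifferentiableAt ℝ (fderiv ℝ F) y :=
    (hF.fderiv_right (m := ∞) (by simp)).differentiableAt_infty
  have h1 : (fun q => ⟪fderiv ℝ F q (Y q), fderiv ℝ F q t⟫_ℝ) =ᶠ[𝓝 y]
      fun q => ⟪secondDeriv F q w z, fderiv ℝ F q t⟫_ℝ :=
    h.eventually.mono fun q hq => hq.inner_christoffel w z t
  have h2 := congrArg (fun L : E →L[ℝ] ℝ => L v) h1.fderiv_eq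
  have h3 := hdF.hasFDerivAt.clm_apply hYd
  have h4 : DifferentiableAt ℝ (fun q => secondDeriv F q w z) y :=
    ((hF.fderiv_apply_const z).fderiv_apply_const w).differentiableAt_infty
  rw [fderiv_inner_apply ℝ h3.differentiableAt (hF.fderiv_apply_const t).differentiableAt_infty,
    fderiv_inner_apply ℝ h4 (hF.fderiv_apply_const t).differentiableAt_infty, h3.fderiv] at h2
  simp only [_root_.add_apply, ContinuousLinearMap.comp_apply,
    ContinuousLinearMap.flip_apply, fderiv_fderiv_eq_secondDeriv hF, inner_add_left] at h2
  rw [hYeq, leviCivita, map_add, inner_add_left, h.inner_christoffel, inner_sub_left]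
  change _ + _ = ⟪fderiv ℝ (fun q => secondDeriv F q w z) y v, _⟫_ℝ + _
  change ⟪_, secondDeriv F y v t⟫_ℝ + _ = ⟪_, secondDeriv F y v t⟫_ℝ + _ at h2
  linarith

end Gauss

section SecondFundamentalForm

variable {E : Type*} [NormedAddCommGroup E] [NormedSpace ℝ E] [FiniteDimensional ℝ E]
  {V : Type*} [NormedAddCommGroup V] [InnerProductSpace ℝ V]
  {F : E → V} {y : E}

lemma normalProjection_eq_self {ξ : V} (hξ : ∀ t, ⟪fderiv ℝ F y t, ξ⟫_ℝ = 0) :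
    normalProjection F y ξ = ξ := by
  rw [normalProjection, Submodule.starProjection_eq_self_iff, Submodule.mem_orthogonal]
  rintro _ ⟨t, rfl⟩
  exact hξ t

lemma inner_fderiv_normalProjection (ξ : V) (t : E) :
    ⟪fderiv ℝ F y t, normalProjection F y ξ⟫_ℝ = 0 :=
  (Submodule.mem_orthogonal _ _).1 (Submodule.starProjection_apply_mem _ ξ) _ ⟨t, rfl⟩

lemma inner_normalProjection_left (ξ η : V) :
    ⟪normalProjection F y ξ, η⟫_ℝ = ⟪ξ, normalProjection F y η⟫_ℝ :=
  Submodule.inner_starProjection_left_eq_right _ _ _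

lemma normalProjection_fderiv (t : E) : normalProjection F y (fderiv ℝ F y t) = 0 := by
  rw [normalProjection, Submodule.starProjection_apply_eq_zero_iff, Submodule.orthogonal_orthogonal]
  exact ⟨t, rfl⟩

lemma normalProjection_idem (ξ : V) :
    normalProjection F y (normalProjection F y ξ) = normalProjection F y ξ :=
  normalProjection_eq_self fun t => inner_fderiv_normalProjection ξ t

lemma inner_secondFundamentalForm {ξ : V} (hξ : ∀ t, ⟪fderiv ℝ F y t, ξ⟫_ℝ = 0) (v w : E) :
    ⟪secondFundamentalForm F y v w, ξ⟫_ℝ = ⟪secondDeriv F y v w, ξ⟫_ℝ := by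
  rw [secondFundamentalForm, inner_normalProjection_left, normalProjection_eq_self hξ, secondDeriv]

/-- The Gauss formula `D_v D_w F = dF (∇_v w) + II(v,w)`. -/
lemma IsSmoothImmersionAt.secondFundamentalForm_eq (h : IsSmoothImmersionAt F y) (v w : E) :
    secondFundamentalForm F y v w = secondDeriv F y v w
      - fderiv ℝ F y (christoffel (firstFundamentalForm F) y v w) := by
  have h1 : normalProjection F y (secondDeriv F y v w
      - fderiv ℝ F y (christoffel (firstFundamentalForm F) y v w)) = _ :=
    normalProjection_eq_self fun t => by
      rw [real_inner_comm, inner_sub_left, h.inner_christoffel, sub_self]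
  rw [← h1, map_sub, normalProjection_fderiv, sub_zero]
  rfl

/-- The Gauss equation. Exchanging the two derivatives of `dF z` cancels the third derivatives
of `F`. -/
lemma IsSmoothImmersionAt.gauss_equation (h : IsSmoothImmersionAt F y) (v w z t : E) :
    firstFundamentalForm F y (riemannCurvature (firstFundamentalForm F) y v w z) t
      = ⟪secondFundamentalForm F y w z, secondFundamentalForm F y v t⟫_ℝ
        - ⟪secondFundamentalForm F y v z, secondFundamentalForm F y w t⟫_ℝ := by
  have key : ∀ a b c d, ⟪secondFundamentalForm F y a b, secondFundamentalForm F y c d⟫_ℝ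
      = ⟪secondDeriv F y a b - fderiv ℝ F y (christoffel (firstFundamentalForm F) y a b),
          secondDeriv F y c d⟫_ℝ := by
    intro a b c d
    rw [real_inner_comm, inner_secondFundamentalForm (ξ := secondFundamentalForm F y a b)
      fun t => inner_fderiv_normalProjection _ t, real_inner_comm, h.secondFundamentalForm_eq a b]
  rw [firstFundamentalForm, riemannCurvature, map_sub, inner_sub_left,
    h.inner_leviCivita_leviCivita, h.inner_leviCivita_leviCivita, key, key,
    secondDeriv_comm (h.contDiffAt.fderiv_apply_const z) v w]
  ring

end SecondFundamentalForm

/-! ### The Ricci equation -/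

section Ricci

variable {E : Type*} [NormedAddCommGroup E] [NormedSpace ℝ E] [FiniteDimensional ℝ E]
  {V : Type*} [NormedAddCommGroup V] [InnerProductSpace ℝ V]
  {F : E → V} {y : E}

/-- The normal projection in terms of the inverse Gram matrix, which exhibits its smooth dependence
on the point. -/
lemma normalProjection_eq_sub (hinj : Function.Injective (fderiv ℝ F y)) :
    normalProjection F y = ContinuousLinearMap.id ℝ V
      - ∑ k, ∑ l, (gramMatrix (firstFundamentalForm F) y)⁻¹ k l •
        (innerSL ℝ (fderiv ℝ F y (Module.finBasis ℝ E l))).smulRight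
          (fderiv ℝ F y (Module.finBasis ℝ E k)) := by
  ext ξ
  set T := ∑ k, ∑ l, ((gramMatrix (firstFundamentalForm F) y)⁻¹ k l *
      ⟪ξ, fderiv ℝ F y (Module.finBasis ℝ E l)⟫_ℝ) • Module.finBasis ℝ E k with hT
  have h1 : ∀ t, ⟪fderiv ℝ F y T, fderiv ℝ F y t⟫_ℝ = ⟪ξ, fderiv ℝ F y t⟫_ℝ := fun t =>
    inner_fderiv_gramMatrix_inv_sum hinj
      ((innerSL ℝ ξ).toLinearMap ∘ₗ (fderiv ℝ F y).toLinearMap) t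
  have h2 : normalProjection F y (ξ - fderiv ℝ F y T) = ξ - fderiv ℝ F y T :=
    normalProjection_eq_self fun t => by rw [real_inner_comm, inner_sub_left, h1, sub_self]
  rw [map_sub, normalProjection_fderiv, sub_zero] at h2
  rw [h2, hT]
  simp [smul_smul, real_inner_comm ξ]

lemma IsSmoothImmersionAt.contDiffAt_normalProjection (h : IsSmoothImmersionAt F y) :
    ContDiffAt ℝ ∞ (normalProjection F) y := by
  have h1 : normalProjection F =ᶠ[𝓝 y] fun q => ContinuousLinearMap.id ℝ V
      - ∑ k, ∑ l, (gramMatrix (firstFundamentalForm F) q)⁻¹ k l •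
        (innerSL ℝ (fderiv ℝ F q (Module.finBasis ℝ E l))).smulRight
          (fderiv ℝ F q (Module.finBasis ℝ E k)) :=
    h.eventually.mono fun q hq => normalProjection_eq_sub hq.injective
  refine ContDiffAt.congr_of_eventuallyEq ?_ h1
  refine contDiffAt_const.sub (ContDiffAt.sum fun k _ => ContDiffAt.sum fun l _ => ?_)
  refine (h.contDiffAt_gramMatrix_inv k l).smul (ContDiffAt.smulRight ?_ ?_)
  · exact (innerSL ℝ).contDiff.contDiffAt.comp y (h.contDiffAt.fderiv_apply_const _)
  · exact h.contDiffAt.fderiv_apply_const _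

/-- The derivative of the normal projection is self-adjoint. -/
lemma IsSmoothImmersionAt.inner_fderiv_normalProjection_left (h : IsSmoothImmersionAt F y)
    (v : E) (ξ η : V) :
    ⟪fderiv ℝ (normalProjection F) y v ξ, η⟫_ℝ = ⟪ξ, fderiv ℝ (normalProjection F) y v η⟫_ℝ := by
  have hP := h.contDiffAt_normalProjection.differentiableAt_infty
  have h1 : ∀ ζ, HasFDerivAt (fun q => normalProjection F q ζ)
      ((fderiv ℝ (normalProjection F) y).flip ζ) y := fun ζ => by
    simpa using hP.hasFDerivAt.clm_apply (hasFDerivAt_const ζ y)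
  have h2 : (fun q => ⟪normalProjection F q ξ, η⟫_ℝ) = fun q => ⟪ξ, normalProjection F q η⟫_ℝ :=
    funext fun q => inner_normalProjection_left ξ η
  have h3 := congrArg (fun f : E → ℝ => fderiv ℝ f y v) h2
  rw [fderiv_inner_apply ℝ (h1 ξ).differentiableAt (differentiableAt_const η),
    fderiv_inner_apply ℝ (differentiableAt_const ξ) (h1 η).differentiableAt] at h3
  simpa [(h1 _).fderiv] using h3

/-- The derivative of the normal projection sends normal vectors to tangent vectors: differentiate
`P ∘ P = P`. -/
lemma IsSmoothImmersionAt.normalProjection_fderiv_normalProjection (h : IsSmoothImmersionAt F y)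
    (v : E) {ξ : V} (hξ : ∀ t, ⟪fderiv ℝ F y t, ξ⟫_ℝ = 0) :
    normalProjection F y (fderiv ℝ (normalProjection F) y v ξ) = 0 := by
  have hP := h.contDiffAt_normalProjection.differentiableAt_infty
  have h1 : HasFDerivAt (fun q => normalProjection F q ξ)
      ((fderiv ℝ (normalProjection F) y).flip ξ) y := by
    simpa using hP.hasFDerivAt.clm_apply (hasFDerivAt_const ξ y)
  have h2 := hP.hasFDerivAt.clm_apply h1
  have h3 : (fun q => normalProjection F q (normalProjection F q ξ))
      = fun q => normalProjection F q ξ := funext fun q => normalProjection_idem ξ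
  rw [h3] at h2
  have h4 := congrArg (fun L : E →L[ℝ] V => L v) (h1.unique h2)
  have h5 : fderiv ℝ (normalProjection F) y v ξ
      = normalProjection F y (fderiv ℝ (normalProjection F) y v ξ)
        + fderiv ℝ (normalProjection F) y v ξ := by
    simpa [normalProjection_eq_self hξ] using h4
  exact right_eq_add.1 h5

/-- The Weingarten equation: differentiate `P (dF t) = 0`. -/
lemma IsSmoothImmersionAt.inner_fderiv_normalProjection_fderiv (h : IsSmoothImmersionAt F y)
    (v t : E) {ξ : V} (hξ : ∀ t, ⟪fderiv ℝ F y t, ξ⟫_ℝ = 0) :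
    ⟪fderiv ℝ (normalProjection F) y v ξ, fderiv ℝ F y t⟫_ℝ = - ⟪ξ, secondDeriv F y v t⟫_ℝ := by
  have hP := h.contDiffAt_normalProjection.differentiableAt_infty
  have h1 := hP.hasFDerivAt.clm_apply
    (h.contDiffAt.fderiv_apply_const t).differentiableAt_infty.hasFDerivAt
  have h2 : (fun q => normalProjection F q (fderiv ℝ F q t)) = fun _ => 0 :=
    funext fun q => normalProjection_fderiv t
  rw [h2] at h1
  have h3 := congrArg (fun L : E →L[ℝ] V => L v) (h1.unique (hasFDerivAt_const 0 y))
  have h4 : normalProjection F y (secondDeriv F y v t)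
      + fderiv ℝ (normalProjection F) y v (fderiv ℝ F y t) = 0 := by simpa [secondDeriv] using h3
  rw [h.inner_fderiv_normalProjection_left, eq_neg_of_add_eq_zero_right h4, inner_neg_right,
    ← inner_normalProjection_left, normalProjection_eq_self hξ]

/-- One half of the normal curvature. The second summand, a second derivative, is symmetric in `v`
and `w`. -/
lemma IsSmoothImmersionAt.inner_normalConnection_normalConnection (h : IsSmoothImmersionAt F y)
    (v w : E) (ν : V) {μ : V} (hμ : ∀ t, ⟪fderiv ℝ F y t, μ⟫_ℝ = 0) :
    ⟪normalConnection F v (normalConnection F w fun q => normalProjection F q ν) y, μ⟫_ℝ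
      = ⟪fderiv ℝ (normalProjection F) y w ν, fderiv ℝ (normalProjection F) y v μ⟫_ℝ
        + ⟪secondDeriv (fun q => normalProjection F q ν) y v w, μ⟫_ℝ := by
  have hP := h.contDiffAt_normalProjection
  have hN : ContDiffAt ℝ ∞ (fun q => normalProjection F q ν) y := hP.clm_apply contDiffAt_const
  have h1 := hP.differentiableAt_infty.hasFDerivAt.clm_apply
    (hN.fderiv_apply_const w).differentiableAt_infty.hasFDerivAt
  have h0 : fderiv ℝ (fun q => normalProjection F q ν) y w
      = fderiv ℝ (normalProjection F) y w ν := by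
    rw [fderiv_clm_apply hP.differentiableAt_infty (differentiableAt_const ν)]
    simp
  have h2 : fderiv ℝ (normalConnection F w fun q => normalProjection F q ν) y v
      = normalProjection F y (secondDeriv (fun q => normalProjection F q ν) y v w)
        + fderiv ℝ (normalProjection F) y v (fderiv ℝ (normalProjection F) y w ν) := by
    rw [← h0]
    exact congrArg (fun L : E →L[ℝ] V => L v) h1.fderiv
  rw [normalConnection, inner_normalProjection_left, normalProjection_eq_self hμ, h2,
    inner_add_left, inner_normalProjection_left, normalProjection_eq_self hμ,
    h.inner_fderiv_normalProjection_left, add_comm]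

/-- The normal curvature is the skew part of the product of two derivatives of the normal
projection. -/
lemma IsSmoothImmersionAt.inner_normalCurvature (h : IsSmoothImmersionAt F y)
    (v w : E) (ν : V) {μ : V} (hμ : ∀ t, ⟪fderiv ℝ F y t, μ⟫_ℝ = 0) :
    ⟪normalCurvature F y v w ν, μ⟫_ℝ
      = ⟪fderiv ℝ (normalProjection F) y w ν, fderiv ℝ (normalProjection F) y v μ⟫_ℝ
        - ⟪fderiv ℝ (normalProjection F) y v ν, fderiv ℝ (normalProjection F) y w μ⟫_ℝ := by
  rw [normalCurvature, inner_sub_left, h.inner_normalConnection_normalConnection v w ν hμ,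
    h.inner_normalConnection_normalConnection w v ν hμ,
    secondDeriv_comm (h.contDiffAt_normalProjection.clm_apply contDiffAt_const) v w]
  ring

end Ricci

/-! ### Equality in the DDVV inequality for matrix families -/

section WintgenFamilies

variable {n κ : Type*} [Fintype n] [Fintype κ]

/-- Equality in the DDVV inequality for the components `A k` of a second fundamental form, with
`c` for the dimension of the manifold. -/
def IsWintgenFamily (c : ℝ) (A : κ → Matrix n n ℝ) : Prop :=
  (∑ k, trace (A k) ^ 2) / c + √(∑ k, ∑ l, commutatorSq (A k) (A l)) = ∑ k, frobeniusSq (A k)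

/-- `C` is the matrix of an isometry into a space of possibly larger dimension: `C * A k * Cᵀ` is
`A k` extended by zero, in other coordinates. -/
lemma isWintgenFamily_conj [DecidableEq n] {n' : Type*} [Fintype n'] {C : Matrix n' n ℝ}
    (hC : Cᵀ * C = 1) (c : ℝ) (A : κ → Matrix n n ℝ) :
    IsWintgenFamily c (fun k => C * A k * Cᵀ) ↔ IsWintgenFamily c A := by
  simp only [IsWintgenFamily, trace_conj hC, frobeniusSq_conj hC, commutatorSq_conj hC]

lemma frobeniusSq_sub_smul_one [DecidableEq n] (c : ℝ) (A : Matrix n n ℝ) :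
    frobeniusSq (A - c • 1) = frobeniusSq A - 2 * c * trace A + c ^ 2 * Fintype.card n := by
  simp only [frobeniusSq_eq_trace, transpose_sub, transpose_smul, transpose_one, Matrix.sub_mul,
    Matrix.mul_sub, trace_sub, Matrix.smul_mul, Matrix.mul_smul, Matrix.one_mul, Matrix.mul_one,
    trace_smul, trace_one, trace_transpose, smul_eq_mul]
  ring

lemma commutatorSq_sub_smul_one [DecidableEq n] (a b : ℝ) (A B : Matrix n n ℝ) :
    commutatorSq (A - a • 1) (B - b • 1) = commutatorSq A B := by
  simp only [commutatorSq, Matrix.sub_mul, Matrix.mul_sub, Matrix.smul_mul, Matrix.mul_smul,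
    Matrix.one_mul, Matrix.mul_one, smul_sub, smul_comm a b]
  congr 1
  abel

/-- The DDVV inequality with the traces split off. -/
lemma trace_add_sqrt_commutatorSq_le [Nonempty n] (A : κ → Matrix n n ℝ)
    (hA : ∀ k, (A k).IsSymm) :
    (∑ k, trace (A k) ^ 2) / Fintype.card n + √(∑ k, ∑ l, commutatorSq (A k) (A l))
      ≤ ∑ k, frobeniusSq (A k) := by
  classical
  have hn : (Fintype.card n : ℝ) ≠ 0 := Nat.cast_ne_zero.2 Fintype.card_ne_zero
  have h1 := sum_commutatorSq_le_sq (fun k => A k - (trace (A k) / Fintype.card n) • 1)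
    (fun k => (hA k).sub (isSymm_one.smul _))
  simp only [commutatorSq_sub_smul_one] at h1
  have h2 := Real.sqrt_le_sqrt h1
  rw [Real.sqrt_sq (Finset.sum_nonneg fun _ _ => frobeniusSq_nonneg _)] at h2
  have h3 : ∀ k, frobeniusSq (A k - (trace (A k) / Fintype.card n) • (1 : Matrix n n ℝ))
      = frobeniusSq (A k) - trace (A k) ^ 2 / Fintype.card n := fun k => by
    rw [frobeniusSq_sub_smul_one]; field_simp; ring
  simp only [h3, Finset.sum_sub_distrib, ← Finset.sum_div] at h2
  linarith

/-- Enlarging the dimension `c` decreases the trace term; as the DDVV inequality holds with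
`Fintype.card n`, equality with a larger `c` is possible only if the traces vanish. -/
lemma isWintgenFamily_iff_of_card_lt [Nonempty n] {c : ℝ} (hc : Fintype.card n < c)
    (A : κ → Matrix n n ℝ) (hA : ∀ k, (A k).IsSymm) :
    IsWintgenFamily c A ↔ (∀ k, trace (A k) = 0) ∧ IsWintgenFamily (Fintype.card n) A := by
  have hn : 0 < (Fintype.card n : ℝ) := Nat.cast_pos.2 Fintype.card_pos
  constructor
  · intro h
    have h1 := trace_add_sqrt_commutatorSq_le A hA
    rw [← h, add_le_add_iff_right] at h1
    have h2 : ∑ k, trace (A k) ^ 2 = 0 := by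
      refine le_antisymm ?_ (by positivity)
      by_contra! h0
      exact (div_lt_div_of_pos_left h0 hn hc).not_ge h1
    refine ⟨fun k => ?_, by simpa [IsWintgenFamily, h2] using h⟩
    simpa using (Finset.sum_eq_zero_iff_of_nonneg fun _ _ => sq_nonneg _).1 h2 k
      (Finset.mem_univ k)
  · rintro ⟨h0, h⟩
    simpa [IsWintgenFamily, h0] using h

end WintgenFamilies

lemma sum_sum_Ioi_eq_half {m : ℕ} (f : Fin m → Fin m → ℝ) (hsymm : ∀ i j, f i j = f j i)
    (hdiag : ∀ i, f i i = 0) : ∑ i, ∑ j ∈ Finset.Ioi i, f i j = (1 / 2) * ∑ i, ∑ j, f i j := by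
  have h1 : ∀ i, ∑ j ∈ Finset.Ioi i, f i j = ∑ j, if i < j then f i j else 0 := fun i => by
    rw [← Finset.sum_filter]; congr 1; ext; simp
  have h2 : ∑ i, ∑ j, f i j = ∑ i, ∑ j, (if i < j then f i j else 0)
      + ∑ i, ∑ j, (if i < j then f i j else 0) := by
    nth_rewrite 3 [Finset.sum_comm]
    simp only [← Finset.sum_add_distrib]
    refine Finset.sum_congr rfl fun i _ => Finset.sum_congr rfl fun j _ => ?_
    rcases lt_trichotomy i j with h | h | h
    · simp [h, h.not_gt]
    · subst h; simp [hdiag]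
    · simp [h, h.not_gt, hsymm i j]
  simp only [h1, h2]; ring

lemma sum_Ioi_commutator_sq {m p : ℕ} (A : Fin p → Matrix (Fin m) (Fin m) ℝ)
    (hA : ∀ a, (A a).IsSymm) :
    ∑ i, ∑ j ∈ Finset.Ioi i, ∑ a, ∑ b ∈ Finset.Ioi a, (A b * A a - A a * A b) i j ^ 2
      = (1 / 2) ^ 2 * ∑ a, ∑ b, commutatorSq (A a) (A b) := by
  have hskew : ∀ a b i j, (A b * A a - A a * A b) j i = -(A b * A a - A a * A b) i j := by
    intro a b i j
    have : (A b * A a - A a * A b)ᵀ = -(A b * A a - A a * A b) := by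
      rw [transpose_sub, transpose_mul, transpose_mul, (hA a).eq, (hA b).eq, neg_sub]
    exact congrFun (congrFun this i) j
  have h1 : ∀ i j, ∑ a, ∑ b ∈ Finset.Ioi a, (A b * A a - A a * A b) i j ^ 2
      = (1 / 2) * ∑ a, ∑ b, (A b * A a - A a * A b) i j ^ 2 := fun i j =>
    sum_sum_Ioi_eq_half _
      (fun a b => by rw [← neg_sub (A a * A b), Matrix.neg_apply, neg_sq]) (fun a => by simp)
  simp only [h1]
  rw [sum_sum_Ioi_eq_half _ (fun i j => by simp only [hskew _ _ i j, neg_sq])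
    fun i => by
      have : ∀ a b, (A b * A a - A a * A b) i i = 0 := fun a b => by linarith [hskew a b i i]
      simp [this]]
  simp only [← Finset.mul_sum]
  rw [← mul_assoc, ← sq]
  congr 1
  rw [Finset.sum_comm_cycle]
  refine Finset.sum_congr rfl fun a _ => ?_
  rw [Finset.sum_comm_cycle]
  exact Finset.sum_congr rfl fun b _ => commutatorSq_comm (A b) (A a)

/-! ### The second fundamental form in orthonormal frames -/

section Frames

variable {E : Type*} [NormedAddCommGroup E] [NormedSpace ℝ E]
  {V : Type*} [NormedAddCommGroup V] [InnerProductSpace ℝ V]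
  {F : E → V} {y : E} {m p : ℕ} {e : Fin m → E} {ν : Fin p → V}

/-- The matrix of the component `⟨II, ξ⟩` of the second fundamental form, for a normal vector `ξ`.
Normality of `ξ` makes the projection of `D_v D_w F` to the normal space superfluous. -/
noncomputable def shapeMatrix (F : E → V) (y : E) (e : Fin m → E) (ξ : V) :
    Matrix (Fin m) (Fin m) ℝ :=
  Matrix.of fun i j => ⟪secondDeriv F y (e i) (e j), ξ⟫_ℝ

lemma isSymm_shapeMatrix (hF : ContDiffAt ℝ ∞ F y) (e : Fin m → E) (ξ : V) :
    (shapeMatrix F y e ξ).IsSymm :=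
  Matrix.IsSymm.ext fun i j => by simp [shapeMatrix, secondDeriv_comm hF (e i)]

lemma exists_isTangentFrame (hinj : Function.Injective (fderiv ℝ F y))
    (hE : Module.finrank ℝ E = m) [FiniteDimensional ℝ E] :
    ∃ e : Fin m → E, IsTangentFrame F y e := by
  have hr : Module.finrank ℝ (LinearMap.range (fderiv ℝ F y).toLinearMap) = m := by
    rw [LinearMap.finrank_range_of_inj hinj, hE]
  set b := (stdOrthonormalBasis ℝ (LinearMap.range (fderiv ℝ F y).toLinearMap)).reindex
    (finCongr hr) with hb
  choose e he using fun i => (b i).2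
  refine ⟨e, ?_⟩
  have : (fun i => fderiv ℝ F y (e i)) = fun i => (b i : V) := funext he
  rw [IsTangentFrame, this]
  exact b.orthonormal.comp_linearIsometry (Submodule.subtypeₗᵢ _)

variable [FiniteDimensional ℝ V]

lemma exists_isNormalFrame (hinj : Function.Injective (fderiv ℝ F y))
    (hE : Module.finrank ℝ E = m) (hV : Module.finrank ℝ V = m + p) :
    ∃ ν : Fin p → V, IsNormalFrame F y ν := by
  have hr : Module.finrank ℝ (LinearMap.range (fderiv ℝ F y).toLinearMap)ᗮ = p := by
    have := (LinearMap.range (fderiv ℝ F y).toLinearMap).finrank_add_finrank_orthogonal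
    rw [LinearMap.finrank_range_of_inj hinj, hE, hV] at this
    omega
  set b := (stdOrthonormalBasis ℝ (LinearMap.range (fderiv ℝ F y).toLinearMap)ᗮ).reindex
    (finCongr hr) with hb
  exact ⟨fun i => b i, b.orthonormal.comp_linearIsometry (Submodule.subtypeₗᵢ _),
    fun a v => (Submodule.mem_orthogonal _ _).1 (b a).2 _ ⟨v, rfl⟩⟩

/-- Parseval's identity in the orthonormal basis of the ambient space made of a tangent and a
normal frame. -/
lemma sum_inner_mul_inner_frame (hV : Module.finrank ℝ V = m + p) (he : IsTangentFrame F y e)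
    (hν : IsNormalFrame F y ν) (X Z : V) :
    ∑ k, ⟪X, fderiv ℝ F y (e k)⟫_ℝ * ⟪fderiv ℝ F y (e k), Z⟫_ℝ + ∑ a, ⟪X, ν a⟫_ℝ * ⟪ν a, Z⟫_ℝ
      = ⟪X, Z⟫_ℝ := by
  have hon : Orthonormal ℝ (Sum.elim (fun i => fderiv ℝ F y (e i)) ν) := by
    refine ⟨?_, ?_⟩
    · rintro (i | a)
      · exact he.1 i
      · exact hν.1.1 a
    · rintro (i | a) (j | b) hab
      · exact he.2 (fun h => hab (congrArg _ h))
      · exact hν.2 b _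
      · exact (real_inner_comm _ _).trans (hν.2 a _)
      · exact hν.1.2 (fun h => hab (congrArg _ h))
  have hspan := hon.linearIndependent.span_eq_top_of_card_eq_finrank' (by simp [hV])
  have := (OrthonormalBasis.mk hon hspan.ge).sum_inner_mul_inner X Z
  simpa using this

variable [FiniteDimensional ℝ E]

lemma inner_secondFundamentalForm_eq_sum (hV : Module.finrank ℝ V = m + p)
    (he : IsTangentFrame F y e) (hν : IsNormalFrame F y ν) (a b c d : E) :
    ⟪secondFundamentalForm F y a b, secondFundamentalForm F y c d⟫_ℝ
      = ∑ k, ⟪secondDeriv F y a b, ν k⟫_ℝ * ⟪secondDeriv F y c d, ν k⟫_ℝ := by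
  rw [← sum_inner_mul_inner_frame hV he hν]
  have h1 : ∀ v, ⟪fderiv ℝ F y v, secondFundamentalForm F y c d⟫_ℝ = 0 := fun v =>
    inner_fderiv_normalProjection _ v
  simp only [h1, mul_zero, Finset.sum_const_zero, zero_add]
  refine Finset.sum_congr rfl fun k _ => ?_
  rw [inner_secondFundamentalForm (hν.2 k), real_inner_comm _ (ν k),
    inner_secondFundamentalForm (hν.2 k)]

lemma norm_sq_meanCurvatureVector (hV : Module.finrank ℝ V = m + p)
    (he : IsTangentFrame F y e) (hν : IsNormalFrame F y ν) :
    ‖meanCurvatureVector F y e‖ ^ 2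
      = (1 / (m : ℝ)) ^ 2 * ∑ k, trace (shapeMatrix F y e (ν k)) ^ 2 := by
  rw [meanCurvatureVector, norm_smul, mul_pow, Real.norm_eq_abs, sq_abs,
    ← real_inner_self_eq_norm_sq, sum_inner]
  simp only [inner_sum, inner_secondFundamentalForm_eq_sum hV he hν]
  congr 1
  simp only [trace, shapeMatrix, Matrix.diag_apply, Matrix.of_apply, sq, Finset.sum_mul_sum]
  rw [Finset.sum_comm_cycle]

lemma normalizedScalarCurvature_eq (h : IsSmoothImmersionAt F y)
    (hV : Module.finrank ℝ V = m + p) (he : IsTangentFrame F y e) (hν : IsNormalFrame F y ν) :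
    normalizedScalarCurvature (firstFundamentalForm F) y e
      = 1 / ((m : ℝ) * (m - 1)) * (∑ k, trace (shapeMatrix F y e (ν k)) ^ 2
        - ∑ k, frobeniusSq (shapeMatrix F y e (ν k))) := by
  have h1 : ∀ i j, firstFundamentalForm F y
      (riemannCurvature (firstFundamentalForm F) y (e i) (e j) (e j)) (e i)
      = ∑ k, (shapeMatrix F y e (ν k) i i * shapeMatrix F y e (ν k) j j
          - shapeMatrix F y e (ν k) i j ^ 2) := by
    intro i j
    rw [h.gauss_equation, inner_secondFundamentalForm_eq_sum hV he hν,
      inner_secondFundamentalForm_eq_sum hV he hν, ← Finset.sum_sub_distrib]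
    refine Finset.sum_congr rfl fun k _ => ?_
    simp only [shapeMatrix, Matrix.of_apply, secondDeriv_comm h.contDiffAt (e j) (e i)]
    ring
  rw [normalizedScalarCurvature]
  simp only [h1]
  rw [sum_sum_Ioi_eq_half]
  · have h2 : ∀ k, trace (shapeMatrix F y e (ν k)) ^ 2 = ∑ i, ∑ j,
        shapeMatrix F y e (ν k) i i * shapeMatrix F y e (ν k) j j := fun k => by
      simp only [trace, Matrix.diag_apply, sq, Finset.sum_mul_sum]
    have h3 : ∑ i, ∑ j, ∑ k, (shapeMatrix F y e (ν k) i i * shapeMatrix F y e (ν k) j j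
        - shapeMatrix F y e (ν k) i j ^ 2) = ∑ k, trace (shapeMatrix F y e (ν k)) ^ 2
        - ∑ k, frobeniusSq (shapeMatrix F y e (ν k)) := by
      rw [Finset.sum_comm_cycle]
      simp only [h2, frobeniusSq, Finset.sum_sub_distrib]
    rw [h3]; ring
  · intro i j
    refine Finset.sum_congr rfl fun k _ => ?_
    rw [(isSymm_shapeMatrix h.contDiffAt e (ν k)).apply i j]; ring
  · intro i
    refine Finset.sum_eq_zero fun k _ => by ring

/-- The Ricci equation: the normal curvature is the commutator of the shape operators. -/
lemma IsSmoothImmersionAt.ricci_equation (h : IsSmoothImmersionAt F y)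
    (hV : Module.finrank ℝ V = m + p) (he : IsTangentFrame F y e) (hν : IsNormalFrame F y ν)
    (i j : Fin m) (a b : Fin p) :
    ⟪normalCurvature F y (e i) (e j) (ν a), ν b⟫_ℝ
      = (shapeMatrix F y e (ν b) * shapeMatrix F y e (ν a)
          - shapeMatrix F y e (ν a) * shapeMatrix F y e (ν b)) i j := by
  have key : ∀ v w c d, ⟪fderiv ℝ (normalProjection F) y w (ν c),
      fderiv ℝ (normalProjection F) y v (ν d)⟫_ℝ
      = ∑ k, ⟪secondDeriv F y w (e k), ν c⟫_ℝ * ⟪secondDeriv F y v (e k), ν d⟫_ℝ := by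
    intro v w c d
    have h1 : ∀ l, ⟪ν l, fderiv ℝ (normalProjection F) y v (ν d)⟫_ℝ = 0 := fun l => by
      rw [← normalProjection_eq_self (hν.2 l), inner_normalProjection_left,
        h.normalProjection_fderiv_normalProjection v (hν.2 d), inner_zero_right]
    rw [← sum_inner_mul_inner_frame hV he hν]
    simp only [h1, mul_zero, Finset.sum_const_zero, add_zero]
    refine Finset.sum_congr rfl fun k _ => ?_
    rw [h.inner_fderiv_normalProjection_fderiv w (e k) (hν.2 c),
      real_inner_comm _ (fderiv ℝ F y (e k)),
      h.inner_fderiv_normalProjection_fderiv v (e k) (hν.2 d), neg_mul_neg, real_inner_comm,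
      real_inner_comm (secondDeriv F y v (e k))]
  rw [h.inner_normalCurvature (e i) (e j) (ν a) (hν.2 b), key, key]
  simp only [Matrix.sub_apply, Matrix.mul_apply, shapeMatrix, Matrix.of_apply]
  congr 1
  · refine Finset.sum_congr rfl fun k _ => ?_
    rw [secondDeriv_comm h.contDiffAt (e j), mul_comm]
  · refine Finset.sum_congr rfl fun k _ => ?_
    rw [secondDeriv_comm h.contDiffAt (e j)]

lemma normalizedNormalCurvature_eq (h : IsSmoothImmersionAt F y)
    (hV : Module.finrank ℝ V = m + p) (he : IsTangentFrame F y e) (hν : IsNormalFrame F y ν) :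
    normalizedNormalCurvature F y e ν = 1 / ((m : ℝ) * (m - 1)) *
      √(∑ a, ∑ b, commutatorSq (shapeMatrix F y e (ν a)) (shapeMatrix F y e (ν b))) := by
  have h1 : ∑ i, ∑ j ∈ Finset.Ioi i, ∑ a, ∑ b ∈ Finset.Ioi a,
      ⟪normalCurvature F y (e i) (e j) (ν a), ν b⟫_ℝ ^ 2
      = (1 / 2) ^ 2 *
        ∑ a, ∑ b, commutatorSq (shapeMatrix F y e (ν a)) (shapeMatrix F y e (ν b)) := by
    simp only [h.ricci_equation hV he hν]
    exact sum_Ioi_commutator_sq _ fun a => isSymm_shapeMatrix h.contDiffAt e (ν a)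
  rw [normalizedNormalCurvature, h1, Real.sqrt_mul (by positivity), Real.sqrt_sq (by norm_num)]
  ring

/-- The equality case of the DDVV inequality in terms of the second fundamental form, by the
equations of Gauss and Ricci. -/
lemma IsSmoothImmersionAt.wintgen_iff (h : IsSmoothImmersionAt F y) (hm : 2 ≤ m)
    (hV : Module.finrank ℝ V = m + p) (he : IsTangentFrame F y e) (hν : IsNormalFrame F y ν) :
    normalizedScalarCurvature (firstFundamentalForm F) y e
        = ‖meanCurvatureVector F y e‖ ^ 2 - normalizedNormalCurvature F y e ν
      ↔ IsWintgenFamily m fun a => shapeMatrix F y e (ν a) := by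
  have hm' : (2 : ℝ) ≤ m := by exact_mod_cast hm
  have h1 : (m : ℝ) ≠ 0 := by linarith
  have h2 : (m : ℝ) - 1 ≠ 0 := by linarith
  rw [normalizedScalarCurvature_eq h hV he hν, norm_sq_meanCurvatureVector hV he hν,
    normalizedNormalCurvature_eq h hV he hν, IsWintgenFamily]
  generalize √(∑ a, ∑ b, commutatorSq (shapeMatrix F y e (ν a)) (shapeMatrix F y e (ν b))) = K
  generalize ∑ a, frobeniusSq (shapeMatrix F y e (ν a)) = N
  generalize ∑ a, trace (shapeMatrix F y e (ν a)) ^ 2 = T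
  have h3 : 1 / ((m : ℝ) * (m - 1)) * (T - N) - ((1 / (m : ℝ)) ^ 2 * T - 1 / (m * (m - 1)) * K)
      = 1 / ((m : ℝ) * (m - 1)) * (T / m + K - N) := by
    field_simp; ring
  rw [← sub_eq_zero, h3, mul_eq_zero, sub_eq_zero]
  simp [h1, h2]

lemma meanCurvatureVector_eq_zero_iff (hm : m ≠ 0)
    (hV : Module.finrank ℝ V = m + p) (he : IsTangentFrame F y e) (hν : IsNormalFrame F y ν) :
    meanCurvatureVector F y e = 0 ↔ ∀ a, trace (shapeMatrix F y e (ν a)) = 0 := by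
  rw [← norm_eq_zero, ← sq_eq_zero_iff, norm_sq_meanCurvatureVector hV he hν, mul_eq_zero,
    Finset.sum_eq_zero_iff_of_nonneg fun _ _ => sq_nonneg _]
  simp [hm]

end Frames

/-! ### Cylinders in coordinates -/

section Cylinders

variable {E : Type*} [NormedAddCommGroup E] [NormedSpace ℝ E]
  {V : Type*} [NormedAddCommGroup V] [InnerProductSpace ℝ V]
  {W : Type*} [NormedAddCommGroup W] [InnerProductSpace ℝ W]
  {F : E → V} {a : E} {b : W}

lemma contDiff_toLp_prod {n : ℕ∞ω} :
    ContDiff ℝ n (WithLp.toLp 2 : V × W → WithLp 2 (V × W)) :=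
  (WithLp.prodContinuousLinearEquiv 2 ℝ V W).symm.contDiff

lemma hasFDerivAt_toLp_comp {X : Type*} [NormedAddCommGroup X] [NormedSpace ℝ X] {f : X → V × W}
    {f' : X →L[ℝ] V × W} {x : X} (hf : HasFDerivAt f f' x) :
    HasFDerivAt (fun q => (WithLp.toLp 2 (f q) : WithLp 2 (V × W)))
      ((WithLp.prodContinuousLinearEquiv 2 ℝ V W).symm.toContinuousLinearMap ∘L f') x :=
  (WithLp.prodContinuousLinearEquiv 2 ℝ V W).symm.hasFDerivAt.comp x hf

lemma fderiv_cylinder (hF : DifferentiableAt ℝ F a) (v : E × W) :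
    fderiv ℝ (cylinder W F) (a, b) v = WithLp.toLp 2 (fderiv ℝ F a v.1, v.2) := by
  have h1 : HasFDerivAt (fun q : E × W => (F q.1, q.2))
      (((fderiv ℝ F a).comp (ContinuousLinearMap.fst ℝ E W)).prod
        (ContinuousLinearMap.snd ℝ E W)) (a, b) :=
    (hF.hasFDerivAt.comp (a, b) hasFDerivAt_fst).prodMk hasFDerivAt_snd
  have h2 := (hasFDerivAt_toLp_comp h1).fderiv
  exact congrArg (fun L => L v) h2

lemma secondDeriv_cylinder (hF : ∀ᶠ q in 𝓝 a, ContDiffAt ℝ ∞ F q) (v w : E × W) :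
    secondDeriv (cylinder W F) (a, b) v w = WithLp.toLp 2 (secondDeriv F a v.1 w.1, 0) := by
  have h0 : (fun q => fderiv ℝ (cylinder W F) q w)
      =ᶠ[𝓝 (a, b)] fun q => WithLp.toLp 2 (fderiv ℝ F q.1 w.1, w.2) := by
    filter_upwards [(continuous_fst.tendsto (a, b)).eventually hF] with q hq
    exact fderiv_cylinder hq.differentiableAt_infty w
  have h1 : HasFDerivAt (fun q : E × W => (fderiv ℝ F q.1 w.1, w.2))
      (((fderiv ℝ (fun q => fderiv ℝ F q w.1) a).comp (ContinuousLinearMap.fst ℝ E W)).prod 0)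
      (a, b) := by
    have hd : HasFDerivAt (fun q => fderiv ℝ F q w.1) (fderiv ℝ (fun q => fderiv ℝ F q w.1) a)
        (a, b).1 := (hF.self_of_nhds.fderiv_apply_const w.1).differentiableAt_infty.hasFDerivAt
    exact (hd.comp (a, b) hasFDerivAt_fst).prodMk (hasFDerivAt_const _ _)
  rw [secondDeriv, h0.fderiv_eq, (hasFDerivAt_toLp_comp h1).fderiv]
  rfl

lemma IsSmoothImmersionAt.cylinder (h : IsSmoothImmersionAt F a) (b : W) :
    IsSmoothImmersionAt (cylinder W F) (a, b) := by
  refine ⟨?_, ?_⟩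
  · filter_upwards [(continuous_fst.tendsto (a, b)).eventually h.eventually_contDiffAt] with q hq
    exact contDiff_toLp_prod.contDiffAt.comp q
      ((hq.comp q contDiffAt_fst).prodMk contDiffAt_snd)
  · intro v w hvw
    rw [fderiv_cylinder h.contDiffAt.differentiableAt_infty,
      fderiv_cylinder h.contDiffAt.differentiableAt_infty] at hvw
    have h1 := Prod.ext_iff.1 ((WithLp.toLp_injective 2) hvw)
    exact Prod.ext (h.injective h1.1) h1.2

variable {m n p : ℕ} {e : Fin n → E} {e' : Fin m → E × W} {ν : Fin p → V}

/-- The normal space of the cylinder is `N × 0`, with `N` the normal space of `F`. -/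
lemma isNormalFrame_cylinder_iff (hF : DifferentiableAt ℝ F a)
    (ν' : Fin p → WithLp 2 (V × W)) :
    IsNormalFrame (cylinder W F) (a, b) ν' ↔
      ∃ ν : Fin p → V, IsNormalFrame F a ν ∧ ν' = fun k => WithLp.toLp 2 (ν k, 0) := by
  have hon : ∀ ν : Fin p → V, Orthonormal ℝ (fun k => (WithLp.toLp 2 (ν k, 0) : WithLp 2 (V × W)))
      ↔ Orthonormal ℝ ν := fun ν => by
    simp only [orthonormal_iff_ite, WithLp.prod_inner_apply]
    simp
  constructor
  · intro h
    have h2 : ν' = fun k => WithLp.toLp 2 ((ν' k).fst, 0) := by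
      funext k
      have h3 : (ν' k).snd = 0 := by
        have := h.2 k (0, (ν' k).snd)
        rw [fderiv_cylinder hF, WithLp.prod_inner_apply] at this
        simpa using this
      rw [← h3]; rfl
    refine ⟨fun k => (ν' k).fst, ⟨?_, fun k v => ?_⟩, h2⟩
    · rw [← hon, ← h2]; exact h.1
    · have := h.2 k (v, 0)
      rw [fderiv_cylinder hF, WithLp.prod_inner_apply] at this
      simpa using this
  · rintro ⟨ν, h, rfl⟩
    refine ⟨(hon ν).2 h.1, fun k v => ?_⟩
    rw [fderiv_cylinder hF, WithLp.prod_inner_apply]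
    simpa using h.2 k v.1

/-- In any frames, the second fundamental form of the cylinder is obtained from that of the
immersion `F` by an isometric change of basis and an extension by zero. -/
lemma exists_shapeMatrix_cylinder_eq_conj [FiniteDimensional ℝ V] [FiniteDimensional ℝ W]
    (h : IsSmoothImmersionAt F a)
    (hV : Module.finrank ℝ V = n + p) (hVW : Module.finrank ℝ (WithLp 2 (V × W)) = m + p)
    (he : IsTangentFrame F a e) (hν : IsNormalFrame F a ν)
    (he' : IsTangentFrame (cylinder W F) (a, b) e') :
    ∃ C : Matrix (Fin m) (Fin n) ℝ, Cᵀ * C = 1 ∧ ∀ k,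
      shapeMatrix (cylinder W F) (a, b) e' (WithLp.toLp 2 (ν k, 0))
        = C * shapeMatrix F a e (ν k) * Cᵀ := by
  have hF := h.contDiffAt.differentiableAt_infty
  have hν' := (isNormalFrame_cylinder_iff (W := W) (b := b) hF _).2 ⟨ν, hν, rfl⟩
  set C : Matrix (Fin m) (Fin n) ℝ :=
    Matrix.of fun i k => ⟪fderiv ℝ F a (e' i).1, fderiv ℝ F a (e k)⟫_ℝ with hC
  have hCc : ∀ i k, C i k = ⟪fderiv ℝ (cylinder W F) (a, b) (e' i),
      fderiv ℝ (cylinder W F) (a, b) (e k, 0)⟫_ℝ := fun i k => by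
    rw [fderiv_cylinder hF, fderiv_cylinder hF, WithLp.prod_inner_apply]; simp [hC]
  have hexp : ∀ i, (e' i).1 = ∑ k, C i k • e k := by
    intro i
    refine h.injective (ext_inner_right ℝ fun z => ?_)
    rw [← sum_inner_mul_inner_frame hV he hν]
    simp [hν.2, map_sum, sum_inner, inner_smul_left, hC]
  refine ⟨C, ?_, fun l => ?_⟩
  · ext k l
    have h1 := sum_inner_mul_inner_frame hVW he' hν'
      (fderiv ℝ (cylinder W F) (a, b) (e k, 0)) (fderiv ℝ (cylinder W F) (a, b) (e l, 0))
    simp only [hν'.2, zero_mul, Finset.sum_const_zero, add_zero, ← hCc] at h1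
    rw [Matrix.mul_apply, Matrix.one_apply]
    have h2 : ⟪fderiv ℝ (cylinder W F) (a, b) (e k, 0), fderiv ℝ (cylinder W F) (a, b) (e l, 0)⟫_ℝ
        = if k = l then 1 else 0 := by
      rw [fderiv_cylinder hF, fderiv_cylinder hF, WithLp.prod_inner_apply]
      simpa using orthonormal_iff_ite.1 he k l
    rw [← h2, ← h1]
    exact Finset.sum_congr rfl fun i _ => by rw [transpose_apply, real_inner_comm, hCc i k]
  · ext i j
    simp only [shapeMatrix, Matrix.of_apply, secondDeriv_cylinder h.eventually_contDiffAt]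
    rw [WithLp.prod_inner_apply, hexp i, hexp j, secondDeriv_sum_smul h.contDiffAt]
    simp only [inner_zero_left, add_zero, sum_inner, inner_smul_left, conj_trivial,
      Matrix.mul_apply, Matrix.of_apply, transpose_apply, Finset.sum_mul]
    rw [Finset.sum_comm]
    exact Finset.sum_congr rfl fun _ _ => Finset.sum_congr rfl fun _ _ => by ring

end Cylinders

/-! ### Manifolds and charts -/

section Charts

variable {E : Type*} [NormedAddCommGroup E] [NormedSpace ℝ E]
  {H : Type*} [TopologicalSpace H] {I : ModelWithCorners ℝ E H}
  {M : Type*} [TopologicalSpace M] [ChartedSpace H M]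

lemma localParametrization_cylinder {W : Type*} [NormedAddCommGroup W] [InnerProductSpace ℝ W]
    {V : Type*} (f : M → V) (x : M × W) :
    localParametrization (I.prod 𝓘(ℝ, W)) (cylinder W f) x
      = cylinder W (localParametrization I f x.1) := by
  simp only [localParametrization, extChartAt_prod, extChartAt_model_space_eq_id]
  rfl

lemma extChartAt_prod_model_apply {W : Type*} [NormedAddCommGroup W] [InnerProductSpace ℝ W]
    (x : M × W) : extChartAt (I.prod 𝓘(ℝ, W)) x x = (extChartAt I x.1 x.1, x.2) := by
  simp only [extChartAt_prod, extChartAt_model_space_eq_id]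
  rfl

variable [I.Boundaryless] {V : Type*} [NormedAddCommGroup V] [InnerProductSpace ℝ V]

lemma mfderiv_eq_fderiv_localParametrization {f : M → V} {x : M}
    (hf : MDifferentiableAt I 𝓘(ℝ, V) f x) :
    mfderiv I 𝓘(ℝ, V) f x = fderiv ℝ (localParametrization I f x) (extChartAt I x x) := by
  refine hf.mfderiv.trans ?_
  rw [I.range_eq_univ, fderivWithin_univ]
  rfl

lemma isSmoothImmersionAt_localParametrization [IsManifold I ∞ M] {f : M → V}
    (hf : ContMDiff I 𝓘(ℝ, V) ∞ f) (hinj : ∀ x, Function.Injective (mfderiv I 𝓘(ℝ, V) f x))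
    (x : M) : IsSmoothImmersionAt (localParametrization I f x) (extChartAt I x x) := by
  refine ⟨?_, ?_⟩
  · filter_upwards [(isOpen_extChartAt_target (I := I) x).mem_nhds
      (mem_extChartAt_target (I := I) x)] with q hq
    have h1 : ContMDiffOn 𝓘(ℝ, E) 𝓘(ℝ, V) ∞ (localParametrization I f x)
        (extChartAt I x).target := hf.comp_contMDiffOn (contMDiffOn_extChartAt_symm x)
    exact h1.contDiffOn.contDiffAt ((isOpen_extChartAt_target (I := I) x).mem_nhds hq)
  · rw [← mfderiv_eq_fderiv_localParametrization (hf.mdifferentiable (by simp) x)]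
    exact hinj x

variable [IsManifold I ∞ M] {r m p : ℕ} {u : M → V}

lemma IsImmersedSubmanifold.isSmoothImmersionAt (hu : IsImmersedSubmanifold I r p u) (x : M) :
    IsSmoothImmersionAt (localParametrization I u x) (extChartAt I x x) :=
  isSmoothImmersionAt_localParametrization hu.contMDiff hu.injective_mfderiv x

variable [FiniteDimensional ℝ E] [FiniteDimensional ℝ V]
  {W : Type*} [NormedAddCommGroup W] [InnerProductSpace ℝ W] [FiniteDimensional ℝ W]

lemma IsImmersedSubmanifold.cylinder (hu : IsImmersedSubmanifold I r p u)
    (hm : r + Module.finrank ℝ W = m) :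
    IsImmersedSubmanifold (I.prod 𝓘(ℝ, W)) m p (cylinder W u) := by
  have hsmooth : ContMDiff (I.prod 𝓘(ℝ, W)) 𝓘(ℝ, WithLp 2 (V × W)) ∞ (_root_.cylinder W u) :=
    contDiff_toLp_prod.contMDiff.comp
      ((hu.contMDiff.comp contMDiff_fst).prodMk_space contMDiff_snd)
  refine ⟨?_, ?_, hsmooth, fun x => ?_⟩
  · rw [Module.finrank_prod, hu.finrank_model, hm]
  · rw [(WithLp.linearEquiv 2 ℝ (V × W)).finrank_eq, Module.finrank_prod, hu.finrank_ambient, ← hm]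
    ring
  · rw [mfderiv_eq_fderiv_localParametrization (hsmooth.mdifferentiable (by simp) x),
      localParametrization_cylinder, extChartAt_prod_model_apply]
    exact ((hu.isSmoothImmersionAt x.1).cylinder x.2).injective

/-- The cylinder theorem for an arbitrary Euclidean factor `W ≠ 0`. -/
theorem isWintgenIdeal_cylinder_iff (hr : 2 ≤ r) (hrm : r < m)
    (hm : r + Module.finrank ℝ W = m) (hu : IsImmersedSubmanifold I r p u) :
    IsWintgenIdeal (I.prod 𝓘(ℝ, W)) m p (cylinder W u) ↔
      IsMinimalSubmanifold I r p u ∧ IsWintgenIdeal I r p u := by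
  have hcyl := hu.cylinder hm
  have : NeZero r := ⟨by omega⟩
  have hcard : (Fintype.card (Fin r) : ℝ) < m := by simpa using hrm
  -- at each point and in each choice of frames, both sides concern conjugate matrix families
  have key : ∀ (x : M) (b : W) (e : Fin r → E) (ν : Fin p → V) (e' : Fin m → E × W),
      IsTangentFrame (localParametrization I u x) (extChartAt I x x) e →
      IsNormalFrame (localParametrization I u x) (extChartAt I x x) ν →
      IsTangentFrame (cylinder W (localParametrization I u x)) (extChartAt I x x, b) e' →
      (IsWintgenFamily m (fun k => shapeMatrix (cylinder W (localParametrization I u x))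
          (extChartAt I x x, b) e' (WithLp.toLp 2 (ν k, 0))) ↔
        meanCurvatureVector (localParametrization I u x) (extChartAt I x x) e = 0 ∧
        normalizedScalarCurvature (firstFundamentalForm (localParametrization I u x))
          (extChartAt I x x) e =
        ‖meanCurvatureVector (localParametrization I u x) (extChartAt I x x) e‖ ^ 2
          - normalizedNormalCurvature (localParametrization I u x) (extChartAt I x x) e ν) := by
    intro x b e ν e' he hν he'
    have h := hu.isSmoothImmersionAt x
    obtain ⟨C, hC, hA⟩ := exists_shapeMatrix_cylinder_eq_conj h hu.finrank_ambient
      hcyl.finrank_ambient he hν he'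
    simp only [hA]
    rw [isWintgenFamily_conj hC, isWintgenFamily_iff_of_card_lt hcard _
      (fun k => isSymm_shapeMatrix h.contDiffAt e (ν k)), h.wintgen_iff hr hu.finrank_ambient he hν,
      meanCurvatureVector_eq_zero_iff (by omega) hu.finrank_ambient he hν, Fintype.card_fin]
  have hnormal : ∀ (x : M) (b : W) (ν : Fin p → V),
      IsNormalFrame (localParametrization I u x) (extChartAt I x x) ν →
      IsNormalFrame (cylinder W (localParametrization I u x)) (extChartAt I x x, b)
        fun k => WithLp.toLp 2 (ν k, 0) := fun x b ν hν =>
    (isNormalFrame_cylinder_iff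
      (hu.isSmoothImmersionAt x).contDiffAt.differentiableAt_infty _).2 ⟨ν, hν, rfl⟩
  constructor
  · rintro ⟨-, hW⟩
    have main : ∀ (x : M) (e : Fin r → E) (ν : Fin p → V),
        IsTangentFrame (localParametrization I u x) (extChartAt I x x) e →
        IsNormalFrame (localParametrization I u x) (extChartAt I x x) ν →
        meanCurvatureVector (localParametrization I u x) (extChartAt I x x) e = 0 ∧
        normalizedScalarCurvature (firstFundamentalForm (localParametrization I u x))
          (extChartAt I x x) e =
        ‖meanCurvatureVector (localParametrization I u x) (extChartAt I x x) e‖ ^ 2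
          - normalizedNormalCurvature (localParametrization I u x) (extChartAt I x x) e ν := by
      intro x e ν he hν
      have hc := (hu.isSmoothImmersionAt x).cylinder (0 : W)
      obtain ⟨e', he'⟩ := exists_isTangentFrame hc.injective hcyl.finrank_model
      have h1 := hW (x, 0) e' (fun k => WithLp.toLp 2 (ν k, 0))
      rw [localParametrization_cylinder, extChartAt_prod_model_apply] at h1
      have h2 := h1 he' (hnormal x 0 ν hν)
      rw [hc.wintgen_iff (by omega) hcyl.finrank_ambient he' (hnormal x 0 ν hν)] at h2
      exact (key x 0 e ν e' he hν he').1 h2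
    refine ⟨⟨hu, fun x e he => ?_⟩, hu, fun x e ν he hν => (main x e ν he hν).2⟩
    obtain ⟨ν, hν⟩ := exists_isNormalFrame (hu.isSmoothImmersionAt x).injective hu.finrank_model
      hu.finrank_ambient
    exact (main x e ν he hν).1
  · rintro ⟨⟨-, hmin⟩, -, hW⟩
    refine ⟨hcyl, fun x e' ν' he' hν' => ?_⟩
    rw [localParametrization_cylinder, extChartAt_prod_model_apply] at he' hν' ⊢
    have h := hu.isSmoothImmersionAt x.1
    obtain ⟨ν, hν, rfl⟩ :=
      (isNormalFrame_cylinder_iff h.contDiffAt.differentiableAt_infty _).1 hν'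
    obtain ⟨e, he⟩ := exists_isTangentFrame h.injective hu.finrank_model
    rw [(h.cylinder x.2).wintgen_iff (by omega) hcyl.finrank_ambient he' hν',
      key x.1 x.2 e ν e' he hν he']
    exact ⟨hmin x.1 e he, hW x.1 e ν he hν⟩

end Charts

theorem proposition3p1 (r m p : ℕ) (hr : 2 ≤ r) (hrm : r < m)
    {M : Type*} [TopologicalSpace M] [ChartedSpace (EuclideanSpace ℝ (Fin r)) M]
    [IsManifold (𝓡 r) ∞ M]
    (u : M → EuclideanSpace ℝ (Fin (r + p))) (hu : IsImmersedSubmanifold (𝓡 r) r p u) :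
    IsWintgenIdeal ((𝓡 r).prod (𝓡 (m - r))) m p
        (cylinder (EuclideanSpace ℝ (Fin (m - r))) u) ↔
      IsMinimalSubmanifold (𝓡 r) r p u ∧ IsWintgenIdeal (𝓡 r) r p u :=
  isWintgenIdeal_cylinder_iff hr hrm (by simp; omega) hu
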